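/- **Theorem (two-sided relative eigenvalue bounds).** Let $\mathcal X$ be a complex Hilbert space, $J$ a hermitian symmetry on $\mathcal X$ ($J=J^*=J^{-1}$), and $G$ a selfadjoint positive definite operator ($(G\psi,\psi)\ge c\|\psi\|^2$ for some $c>0$) with closed form $g$ on the form domain $\mathcal D=\mathcal D(G^{1/2})$. Suppose that $H=JG$ is $J$-spectral, i.e. $J$-selfadjoint ($H^*=JHJ$) and similar to a selfadjoint operator. Let $\delta g$ be a symmetric form on $\mathcal D$ with $$|\delta g(\psi,\psi)|\le\kappa\, g(\psi,\psi)\quad(\psi\in\mathcal D),\qquad 0\le\kappa<1,$$ let $G'$ be the operator defined by the form $g'=g+\delta g$, and let $H'=JG'$. Let $\sigma^+\in(0,\infty]$ be the infimum of the positive essential spectrum and $\sigma^-\in[-\infty,0)$ the supremum of the negative essential spectrum of $H$ (with $\inf\emptyset=+\infty$, $\sup\emptyset=-\infty$). For $k\ge1$ let $\lambda_k^+$ be the $k$-th eigenvalue of $H$ in $(0,\sigma^+)$, in increasing order and counted with multiplicity, and $\lambda_k^+=\sigma^+$ if there are fewer than $k$ of them; let $\lambda_k^-$ be the $k$-th eigenvalue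 of $H$ in $(\sigma^-,0)$, in decreasing order and counted with multiplicity, and $\lambda_k^-=\sigma^-$ if there are fewer than $k$ of them. Define $\sigma'^\pm$, $\lambda_k'^\pm$ in the same way for $H'$. Then for all $k\ge1$ $$-\kappa\le\frac{\lambda_k'^\pm-\lambda_k^\pm}{\lambda_k^\pm}\le\kappa ,$$ where for infinite $\lambda_k^\pm$ this means $\lambda_k'^\pm=\lambda_k^\pm$ (and $\lambda_k'^\pm$ is finite whenever $\lambda_k^\pm$ is). Moreover, if $n\ge1$ is such that $(1+\kappa)\lambda_n^+<(1-\kappa)\sigma^+$, then $\lambda_1'^+,\dots,\lambda_n'^+$ are isolated eigenvalues of $H'$ of finite multiplicity, each of which occurs in the sequence $(\lambda_k'^+)_{k\ge1}$ as often as its multiplicity. Likewise, if $(1+\kappa)\lambda_n^->(1-\kappa)\sigma^-$, then $\lambda_1'^-,\dots,\lambda_n'^-$ are isolated eigenvalues of $H'$ of finite multiplicity, each occurring in $(\lambda_k'^-)_{k\ge1}$ as often as its multiplicity. -/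

import Mathlib

open scoped ComplexConjugate InnerProductSpace

noncomputable section

namespace KreinPerturbation

variable {X : Type*} [NormedAddCommGroup X] [InnerProductSpace ℂ X]

/-! ### Unbounded operators: spectrum, essential spectrum, eigenspaces -/

/-- The map `T - z I` on the domain of the unbounded operator `T`. -/
def shift (T : X →ₗ.[ℂ] X) (z : ℂ) : T.domain →ₗ[ℂ] X :=
  T.toFun - z • T.domain.subtype

/-- `z` lies in the resolvent set: `T - z I` has an everywhere defined bounded two-sided inverse. -/
def InResolventSet (T : X →ₗ.[ℂ] X) (z : ℂ) : Prop :=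
  ∃ R : X →L[ℂ] X,
    (∀ ψ : T.domain, R (shift T z ψ) = ψ) ∧ ∀ x : X, ∃ ψ : T.domain, (ψ : X) = R x ∧ shift T z ψ = x

/-- The spectrum of an unbounded operator. -/
def spec (T : X →ₗ.[ℂ] X) : Set ℂ := {z | ¬ InResolventSet T z}

/-- `T - z I` is Fredholm: finite-dimensional kernel, closed range of finite codimension. -/
def IsFredholmAt (T : X →ₗ.[ℂ] X) (z : ℂ) : Prop :=
  FiniteDimensional ℂ (LinearMap.ker (shift T z)) ∧
    IsClosed (LinearMap.range (shift T z) : Set X) ∧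
      FiniteDimensional ℂ (X ⧸ LinearMap.range (shift T z))

/-- The essential spectrum: the points `z` where `T - z I` is not Fredholm. -/
def essSpec (T : X →ₗ.[ℂ] X) : Set ℂ := {z | ¬ IsFredholmAt T z}

/-- The eigenspace `ker (T - z I)`, as a subspace of `X`. -/
def eigenspace (T : X →ₗ.[ℂ] X) (z : ℂ) : Submodule ℂ X :=
  (LinearMap.ker (shift T z)).map T.domain.subtype

/-- `σ⁺`: the infimum of the positive essential spectrum (`+∞` if there is none). -/
def sigmaPos (T : X →ₗ.[ℂ] X) : EReal :=
  sInf {t : EReal | ∃ r : ℝ, t = r ∧ 0 < r ∧ (r : ℂ) ∈ essSpec T}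

/-- `σ⁻`: the supremum of the negative essential spectrum (`-∞` if there is none). -/
def sigmaNeg (T : X →ₗ.[ℂ] X) : EReal :=
  sSup {t : EReal | ∃ r : ℝ, t = r ∧ r < 0 ∧ (r : ℂ) ∈ essSpec T}

/-- `λ_k⁺` (`k ≥ 1`): the `k`-th positive eigenvalue below `σ⁺`, in increasing order and counted with
multiplicity, and `σ⁺` if there are fewer than `k` of them. It is the smallest `r` in `(0, σ⁺)` such
that the eigenspaces to the eigenvalues in `(0, r]` together span at least `k` dimensions. -/
def eigPos (T : X →ₗ.[ℂ] X) (k : ℕ) : EReal :=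
  sInf ({sigmaPos T} ∪ {t : EReal | ∃ r : ℝ, t = r ∧ 0 < r ∧ (r : EReal) < sigmaPos T ∧
    (k : Cardinal) ≤ Module.rank ℂ (⨆ s ∈ Set.Ioc (0 : ℝ) r, eigenspace T (s : ℂ) : Submodule ℂ X)})

/-- `λ_k⁻` (`k ≥ 1`): the `k`-th negative eigenvalue above `σ⁻`, in decreasing order and counted with
multiplicity, and `σ⁻` if there are fewer than `k` of them. -/
def eigNeg (T : X →ₗ.[ℂ] X) (k : ℕ) : EReal :=
  sSup ({sigmaNeg T} ∪ {t : EReal | ∃ r : ℝ, t = r ∧ r < 0 ∧ sigmaNeg T < (r : EReal) ∧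
    (k : Cardinal) ≤ Module.rank ℂ (⨆ s ∈ Set.Ico r (0 : ℝ), eigenspace T (s : ℂ) : Submodule ℂ X)})

/-- `l` is an eigenvalue of `T`, isolated in the spectrum of `T`. -/
def IsIsolatedEigenvalue (T : X →ₗ.[ℂ] X) (l : ℝ) : Prop :=
  eigenspace T (l : ℂ) ≠ ⊥ ∧ ∃ ε : ℝ, 0 < ε ∧ ∀ z ∈ spec T, ‖z - (l : ℂ)‖ < ε → z = (l : ℂ)

/-- The extended real `a` is the value of an isolated eigenvalue of `T` of finite multiplicity,
and `a` occurs in the sequence `u 1, u 2, …` exactly as often as this multiplicity says. -/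
def IsIsolatedEigenvalueIn (T : X →ₗ.[ℂ] X) (u : ℕ → EReal) (a : EReal) : Prop :=
  ∃ l : ℝ, a = l ∧ IsIsolatedEigenvalue T l ∧ FiniteDimensional ℂ (eigenspace T (l : ℂ)) ∧
    {i : ℕ | 1 ≤ i ∧ u i = a}.ncard = Module.finrank ℂ (eigenspace T (l : ℂ))

/-- `-κ ≤ (a' - a) / a ≤ κ`; if `a` is infinite this is read as `a' = a`. -/
def RelClose (κ : ℝ) (a a' : EReal) : Prop :=
  ((a = ⊤ ∨ a = ⊥) ∧ a' = a) ∨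
    ∃ l l' : ℝ, l ≠ 0 ∧ a = l ∧ a' = l' ∧ -κ ≤ (l' - l) / l ∧ (l' - l) / l ≤ κ

/-! ### Forms and the operators they define -/

/-- Sesquilinear forms with domain `D`; like `⟪·, ·⟫_ℂ` they are antilinear in the first slot. -/
abbrev SesqForm (D : Submodule ℂ X) := D →ₗ⋆[ℂ] D →ₗ[ℂ] ℂ

/-- `q` is symmetric (hermitian). -/
def IsSymmForm {D : Submodule ℂ X} (q : SesqForm D) : Prop :=
  ∀ ψ φ : D, q ψ φ = conj (q φ ψ)

/-- A densely defined, symmetric, positive definite (bounded below by `c > 0`), closed form. -/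
structure IsClosedPosDefForm {D : Submodule ℂ X} (q : SesqForm D) : Prop where
  dense : Dense (D : Set X)
  symm : IsSymmForm q
  pos : ∃ c : ℝ, 0 < c ∧ ∀ ψ : D, c * ‖(ψ : X)‖ ^ 2 ≤ (q ψ ψ).re
  closed : ∀ (u : ℕ → D) (x : X),
    Filter.Tendsto (fun n => (u n : X)) Filter.atTop (nhds x) →
    Filter.Tendsto (fun p : ℕ × ℕ => (q (u p.1 - u p.2) (u p.1 - u p.2)).re) Filter.atTop (nhds 0) →
    ∃ ψ : D, (ψ : X) = x ∧
      Filter.Tendsto (fun n => (q (u n - ψ) (u n - ψ)).re) Filter.atTop (nhds 0)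

/-- The graph of the operator defined by the form `q`: all `(ψ, η)` with `ψ ∈ D` and
`q(φ, ψ) = ⟪φ, η⟫` for all `φ ∈ D`. -/
def formGraph {D : Submodule ℂ X} (q : SesqForm D) : Submodule ℂ (X × X) where
  carrier := {p | ∃ ψ : D, (ψ : X) = p.1 ∧ ∀ φ : D, q φ ψ = ⟪(φ : X), p.2⟫_ℂ}
  add_mem' := by
    rintro ⟨a, b⟩ ⟨c, d⟩ ⟨ψ, h1, h2⟩ ⟨χ, h3, h4⟩
    refine ⟨ψ + χ, by simp_all, fun φ => ?_⟩
    simp [h2 φ, h4 φ]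
  zero_mem' := ⟨0, by simp, fun φ => by simp⟩
  smul_mem' := by
    rintro z ⟨a, b⟩ ⟨ψ, h1, h2⟩
    refine ⟨z • ψ, by simp_all, fun φ => ?_⟩
    simp [h2 φ]

/-- The operator defined by a densely defined form. -/
def formOperator {D : Submodule ℂ X} (q : SesqForm D) : X →ₗ.[ℂ] X :=
  (formGraph q).toLinearPMap

/-- For a densely defined form, `formOperator` has the graph `formGraph`. -/
theorem formOperator_graph {D : Submodule ℂ X} (q : SesqForm D) (hD : Dense (D : Set X)) :
    (formOperator q).graph = formGraph q := by
  refine Submodule.toLinearPMap_graph_eq _ ?_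
  rintro ⟨a, b⟩ ⟨ψ, h1, h2⟩ h0
  have hψ : ψ = 0 := Subtype.ext (by simpa using h1.trans h0)
  refine hD.eq_zero_of_inner_right (𝕜 := ℂ) fun v hv => ?_
  simpa [hψ] using (h2 ⟨v, hv⟩).symm

/-- `q` is the closed form of the positive definite operator `G`. -/
def IsFormOf {D : Submodule ℂ X} (q : SesqForm D) (G : X →ₗ.[ℂ] X) : Prop :=
  IsClosedPosDefForm q ∧ G = formOperator q

/-! ### Positive definite and `J`-spectral operators -/

/-- `G` is selfadjoint and positive definite: `(G ψ, ψ) ≥ c ‖ψ‖²` with some `c > 0`. -/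
def IsPosDefOperator [CompleteSpace X] (G : X →ₗ.[ℂ] X) : Prop :=
  IsSelfAdjoint G ∧ ∃ c : ℝ, 0 < c ∧ ∀ ψ : G.domain, c * ‖(ψ : X)‖ ^ 2 ≤ (⟪(ψ : X), G ψ⟫_ℂ).re

/-- `J` is a hermitian symmetry: `J = J* = J⁻¹`. -/
def IsHermitianSymmetry [CompleteSpace X] (J : X →L[ℂ] X) : Prop :=
  IsSelfAdjoint J ∧ J * J = 1

/-- The operator `J G`, with the domain of `G`. -/
def mulOp (J : X →L[ℂ] X) (G : X →ₗ.[ℂ] X) : X →ₗ.[ℂ] X :=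
  (J : X →ₗ[ℂ] X).compPMap G

/-- `H` is similar to a selfadjoint operator: `S H S⁻¹` is selfadjoint for some bounded `S` with
bounded inverse. -/
def IsSimilarToSelfAdjoint [CompleteSpace X] (H : X →ₗ.[ℂ] X) : Prop :=
  ∃ (S : X ≃L[ℂ] X) (A : X →ₗ.[ℂ] X), IsSelfAdjoint A ∧
    ∀ x y : X, (x, y) ∈ H.graph ↔ (S x, S y) ∈ A.graph

/-- `H` is `J`-spectral: `J`-selfadjoint, i.e. `H* = J H J`, and similar to a selfadjoint operator. -/
def IsJSpectral [CompleteSpace X] (J : X →L[ℂ] X) (H : X →ₗ.[ℂ] X) : Prop :=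
  (∀ x y : X, (x, y) ∈ H.adjoint.graph ↔ (J x, J y) ∈ H.graph) ∧ IsSimilarToSelfAdjoint H

end KreinPerturbation

end

/-!
The eigenvalues of `J G` in `(0, σ⁺)` are the reciprocals of the positive eigenvalues of the bounded
selfadjoint operator `ι* J ι`, where `ι` embeds the form domain with inner product `g`. They are
governed by a variational principle for `(J ψ, ψ) / g(ψ, ψ)`, which is monotone in `g`. The argument
works for every hermitian symmetry `J`; similarity of `J G` to a selfadjoint operator is not needed.
-/

/-! Let `K` be the form domain with `g` as inner product and `ι : K → X` the inclusion. The weak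
definition of `G` gives `G⁻¹ = ι ι*`, hence `(J G)⁻¹ = P Q` with `P = ι` and `Q = ι* J`
(`isInverseOf_mulOp`). The swapped product `A = Q P = ι* J ι` is bounded and selfadjoint on `K`,
with `⟪ψ, A ψ⟫ = (ψ, J ψ)`. Since `J G - z` is `1 - z P Q` composed with `J G`, its kernel, range,
invertibility and Fredholm property can be studied through the pencil `1 - z A`.

The spectral theory of `A` shows that `λ_k⁺` is the infimum of the `r > 0` such that `g(ψ, ψ) ≤ r
(ψ, J ψ)` on some subspace of dimension at least `k`. One half
(`IsInverseOf.hasLargeSubspace_of_eigPos_lt`) takes a span of eigenvectors or, beyond a point of the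
essential spectrum, the infinite-dimensional range of a positive part. The other half
(`IsInverseOf.eigPos_le_of_hasLargeSubspace`) holds because `1 - r A` is strictly positive on the
complement of the eigenvectors, so a trial subspace projects injectively onto their span.

The form enters this criterion on the left side only, so `(1 - κ) g ≤ g' ≤ (1 + κ) g` moves `r` by
the factors `1 + κ` and `1 / (1 - κ)` while the trial subspace stays the same. Negative eigenvalues
are the positive ones for `-J`. For isolation, if some `λ'_k` with `k ≤ n` were equal to `σ'⁺`, all
`λ'_j` would be at most `(1 + κ) λ_n`, which would keep all `λ_j` away from `σ⁺`; but the `λ_j`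
exceed every number below `σ⁺`. -/

noncomputable section

namespace KreinPerturbation

/-! ### Selfadjoint pencils `1 - z A` near a point where the range is closed -/

section Pencil

variable {K : Type*} [NormedAddCommGroup K] [InnerProductSpace ℂ K]

/-- The pencil `1 - z A`. -/
def pencil (A : K →L[ℂ] K) (z : ℂ) : K →L[ℂ] K := 1 - z • A

@[simp]
theorem pencil_apply (A : K →L[ℂ] K) (z : ℂ) (x : K) : pencil A z x = x - z • A x := rfl

theorem mem_ker_pencil {A : K →L[ℂ] K} {z : ℂ} {x : K} : x ∈ (pencil A z).ker ↔ x = z • A x := by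
  simp [LinearMap.mem_ker, sub_eq_zero]

theorem pencil_map_ker {A : K →L[ℂ] K} (l : ℝ) (z : ℂ) {e : K} (he : e ∈ (pencil A l).ker) :
    pencil A z e ∈ (pencil A l).ker := by
  rw [mem_ker_pencil] at he ⊢
  simp only [pencil_apply, map_sub, map_smul, smul_sub]
  have h2 : (l : ℂ) • A (A e) = A e := by rw [← map_smul, ← he]
  rw [smul_comm (l : ℂ), h2, ← he]

theorem norm_le_norm_add_of_mem_orthogonal {N : Submodule ℂ K} {x y : K} (hx : x ∈ N)
    (hy : y ∈ Nᗮ) : ‖x‖ ≤ ‖x + y‖ ∧ ‖y‖ ≤ ‖x + y‖ := by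
  have h := norm_add_sq_eq_norm_sq_add_norm_sq_of_inner_eq_zero (𝕜 := ℂ) x y (hy x hx)
  constructor <;> nlinarith [norm_nonneg x, norm_nonneg y, norm_nonneg (x + y)]

variable [CompleteSpace K] {A : K →L[ℂ] K}

theorem inner_apply_comm (hA : IsSelfAdjoint A) (x y : K) : ⟪A x, y⟫_ℂ = ⟪x, A y⟫_ℂ :=
  ContinuousLinearMap.isSelfAdjoint_iff_isSymmetric.mp hA x y

theorem inner_pencil (hA : IsSelfAdjoint A) (z : ℂ) (x y : K) :
    ⟪pencil A z x, y⟫_ℂ = ⟪x, pencil A (conj z) y⟫_ℂ := by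
  simp [inner_apply_comm hA, mul_comm]

theorem pencil_map_orthogonal_ker (hA : IsSelfAdjoint A) (l : ℝ) (z : ℂ) {f : K}
    (hf : f ∈ (pencil A l).kerᗮ) : pencil A z f ∈ (pencil A l).kerᗮ := by
  intro e he
  rw [← Complex.conj_conj z, ← inner_pencil hA]
  refine hf _ ?_
  rw [mem_ker_pencil] at he ⊢
  simp only [pencil_apply, map_sub, map_smul, smul_sub]
  have h2 : (l : ℂ) • A (A e) = A e := by rw [← map_smul, ← he]
  rw [smul_comm (l : ℂ), h2, ← he]

/-- Restricted to the complement of its kernel, `M` is injective with the same closed range, so the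
open mapping theorem bounds the inverse. -/
theorem exists_bound_orthogonal_ker {M : K →L[ℂ] K} (h : IsClosed (Set.range M)) :
    ∃ C : ℝ, 0 < C ∧ ∀ f ∈ M.kerᗮ, ‖f‖ ≤ C * ‖M f‖ := by
  set R : M.kerᗮ →L[ℂ] K := M ∘L M.kerᗮ.subtypeL with hR
  have hinj : Function.Injective R := by
    rw [injective_iff_map_eq_zero]
    intro f hf
    have h1 : (f : K) ∈ M.ker := hf
    exact Subtype.ext (inner_self_eq_zero (𝕜 := ℂ) |>.mp (f.2 _ h1))
  have hrange : Set.range R = Set.range M := by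
    apply le_antisymm
    · rintro _ ⟨f, rfl⟩
      exact ⟨f, rfl⟩
    · rintro _ ⟨x, rfl⟩
      obtain ⟨e, he, f, hf, rfl⟩ := M.ker.exists_add_mem_mem_orthogonal x
      refine ⟨⟨f, hf⟩, ?_⟩
      have : M e = 0 := he
      simp [hR, this]
  obtain ⟨c, hc⟩ := R.antilipschitz_of_injective_of_isClosed_range hinj (hrange ▸ h)
  -- The antilipschitz constant `c` may vanish; adding 1 makes the bound strictly positive.
  refine ⟨c + 1, by positivity, fun f hf => ?_⟩
  have h2 : ‖f‖ ≤ c * ‖M f‖ := ContinuousLinearMap.bound_of_antilipschitz R hc ⟨f, hf⟩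
  nlinarith [norm_nonneg (M f)]

/-- The bound on `M` gives injectivity and closed range. The bound on the formal adjoint `M'` gives
dense range, because vectors orthogonal to the range of `M` are killed by `M'`. -/
theorem isUnit_of_bound {M M' : K →L[ℂ] K} (hadj : ∀ x y, ⟪M x, y⟫_ℂ = ⟪x, M' y⟫_ℂ)
    {C C' : ℝ} (h : ∀ x, ‖x‖ ≤ C * ‖M x‖) (h' : ∀ x, ‖x‖ ≤ C' * ‖M' x‖) : IsUnit M := by
  rw [ContinuousLinearMap.isUnit_iff_bijective,
    ContinuousLinearMap.bijective_iff_dense_range_and_antilipschitz]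
  refine ⟨?_, C.toNNReal, M.antilipschitz_of_bound fun x => (h x).trans ?_⟩
  · rw [Submodule.topologicalClosure_eq_top_iff, Submodule.eq_bot_iff]
    intro y hy
    have h0 : M' y = 0 := by
      rw [← inner_self_eq_zero (𝕜 := ℂ), ← hadj]
      exact hy _ ⟨_, rfl⟩
    simpa [h0] using h' y
  · gcongr
    exact Real.le_coe_toNNReal C

/-- If `1 - l A` has closed range, then `1 - z A` is invertible for all `z ≠ l` near `l`. -/
theorem exists_isUnit_pencil_near (hA : IsSelfAdjoint A) (l : ℝ)
    (hcl : IsClosed (Set.range (pencil A l))) :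
    ∃ δ : ℝ, 0 < δ ∧ ∀ z : ℂ, z ≠ l → ‖z - l‖ < δ → IsUnit (pencil A z) := by
  obtain ⟨C, hC, hbd⟩ := exists_bound_orthogonal_ker hcl
  -- This radius makes `C ‖z - l‖ ‖A‖ ≤ 1/2`, so on the complement of the kernel the perturbation
  -- `(z - l) A` costs at most half of the lower bound.
  refine ⟨(2 * C * (‖A‖ + 1))⁻¹, by positivity, fun z hz hzl => ?_⟩
  -- The estimate is needed at `z` and at `conj z`, the parameter of the adjoint pencil. The kernel
  -- of `1 - l A` and its complement are both invariant: on the former `l (1 - w A)` is the scalar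
  -- `l - w`, on the latter `1 - w A` is a small perturbation of `1 - l A`.
  have key : ∀ w : ℂ, ‖w - l‖ = ‖z - l‖ →
      ∀ x, ‖x‖ ≤ ((|l| + 1) / ‖z - l‖ + 2 * C) * ‖pencil A w x‖ := by
    intro w hw x
    have hpos : 0 < ‖z - l‖ := norm_pos_iff.mpr (sub_ne_zero.mpr hz)
    obtain ⟨e, he, f, hf, rfl⟩ := (pencil A (l : ℂ)).ker.exists_add_mem_mem_orthogonal x
    have hle := norm_le_norm_add_of_mem_orthogonal (pencil_map_ker l w he)
      (pencil_map_orthogonal_ker hA l w hf)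
    rw [← map_add] at hle
    have h1 : ‖e‖ ≤ (|l| + 1) / ‖z - l‖ * ‖pencil A w e‖ := by
      have h2 : (l : ℂ) • pencil A w e = (l - w : ℂ) • e := by
        have := mem_ker_pencil.mp he
        rw [pencil_apply, smul_sub, smul_comm, ← this, sub_smul]
      have h3 := congrArg norm h2
      rw [norm_smul, norm_smul, norm_sub_rev, hw, Complex.norm_real, Real.norm_eq_abs] at h3
      rw [div_mul_eq_mul_div, le_div_iff₀ hpos]
      nlinarith [norm_nonneg (pencil A w e)]
    have h4 : ‖f‖ ≤ 2 * C * ‖pencil A w f‖ := by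
      have h5 : pencil A (l : ℂ) f = pencil A w f + (w - l) • A f := by
        simp [sub_smul]
      have h6 : ‖pencil A (l : ℂ) f‖ ≤ ‖pencil A w f‖ + ‖z - l‖ * (‖A‖ * ‖f‖) := by
        rw [h5]
        refine (norm_add_le _ _).trans ?_
        rw [norm_smul, hw]
        gcongr
        exact A.le_opNorm f
      have h7 := hbd f hf
      have h8 : ‖z - l‖ * (2 * C * (‖A‖ + 1)) < 1 := by
        rwa [lt_inv_comm₀ hpos (by positivity), ← one_div, lt_div_iff₀ hpos, mul_comm] at hzl
      have h9 : C * (‖z - l‖ * (‖A‖ * ‖f‖)) ≤ ‖f‖ / 2 := by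
        have : C * (‖z - l‖ * (‖A‖ * ‖f‖)) ≤ (‖z - l‖ * (2 * C * (‖A‖ + 1))) * (‖f‖ / 2) := by
          have : 0 ≤ C * ‖z - l‖ * ‖f‖ := by positivity
          nlinarith
        nlinarith [norm_nonneg f]
      nlinarith [norm_nonneg f]
    calc ‖e + f‖ ≤ ‖e‖ + ‖f‖ := norm_add_le _ _
      _ ≤ (|l| + 1) / ‖z - l‖ * ‖pencil A w (e + f)‖ + 2 * C * ‖pencil A w (e + f)‖ := by
        refine add_le_add (h1.trans ?_) (h4.trans ?_)
        · gcongr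
          exact hle.1
        · gcongr
          exact hle.2
      _ = _ := by ring
  refine isUnit_of_bound (M' := pencil A (conj z)) (inner_pencil hA z) (key z rfl) (key _ ?_)
  rw [← Complex.norm_conj (z - l)]
  simp

/-- Eigenvalues of the pencil do not accumulate at points where its range is closed. -/
theorem finite_setOf_ker_pencil_ne_bot (hA : IsSelfAdjoint A) (r : ℝ)
    (hcl : ∀ s : ℝ, 0 < s → s ≤ r → IsClosed (Set.range (pencil A s))) :
    {s : ℝ | 0 < s ∧ s ≤ r ∧ (pencil A s).ker ≠ ⊥}.Finite := by
  -- At `s = 0` the pencil is the identity, so the interval may be closed up to a compact one, on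
  -- which local finiteness is finiteness.
  have hclosed : ∀ s ∈ Set.Icc 0 r, IsClosed (Set.range (pencil A s)) := by
    rintro s ⟨h0, hs⟩
    rcases h0.eq_or_lt with rfl | h0
    · have : Set.range (pencil A ((0 : ℝ) : ℂ)) = Set.univ :=
        Set.range_eq_univ.mpr fun x => ⟨x, by simp⟩
      rw [this]
      exact isClosed_univ
    · exact hcl s h0 hs
  have hfin : ({s : ℝ | (pencil A s).ker ≠ ⊥} ∩ Set.Icc 0 r).Finite := by
    refine (isCompact_Icc (a := (0 : ℝ)) (b := r)).induction_on
      (p := fun t => ({s : ℝ | (pencil A s).ker ≠ ⊥} ∩ t).Finite) (by simp)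
      (fun s t hst ht => ht.subset (Set.inter_subset_inter_right _ hst))
      (fun s t hs ht => by rw [Set.inter_union_distrib_left]; exact hs.union ht) ?_
    intro l hl
    obtain ⟨δ, hδ, h⟩ := exists_isUnit_pencil_near hA l (hclosed l hl)
    refine ⟨Metric.ball l δ, mem_nhdsWithin_of_mem_nhds (Metric.ball_mem_nhds l hδ),
      (Set.finite_singleton l).subset ?_⟩
    rintro s ⟨hs, hsl⟩
    by_contra hne
    refine hs ?_
    have hu := h s (by simpa using hne) (by
      rw [← Complex.ofReal_sub, Complex.norm_real]
      exact hsl)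
    exact LinearMap.ker_eq_bot.mpr (ContinuousLinearMap.isUnit_iff_bijective.mp hu).1
  refine hfin.subset ?_
  rintro s ⟨h0, h1, h2⟩
  exact ⟨h2, h0.le, h1⟩

end Pencil

/-! ### Variational principle for `⟪x, A x⟫ / ‖x‖²` -/

section Variational

variable {K : Type*} [NormedAddCommGroup K] [InnerProductSpace ℂ K] {A : K →L[ℂ] K}

/-- The span of the kernels of `1 - s A`, `0 < s ≤ r`. -/
def pencilSpan (A : K →L[ℂ] K) (r : ℝ) : Submodule ℂ K := ⨆ s ∈ Set.Ioc (0 : ℝ) r, (pencil A s).ker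

/-- There is a subspace of dimension at least `k` on which `‖x‖² ≤ r (A x, x)`. -/
def HasLargeSubspace (A : K →L[ℂ] K) (k : ℕ) (r : ℝ) : Prop :=
  ∃ S : Submodule ℂ K, (k : Cardinal) ≤ Module.rank ℂ S ∧ ∀ x ∈ S, ‖x‖ ^ 2 ≤ r * (⟪x, A x⟫_ℂ).re

theorem finiteDimensional_pencilSpan {r : ℝ}
    (hfin : {s : ℝ | 0 < s ∧ s ≤ r ∧ (pencil A s).ker ≠ ⊥}.Finite)
    (hker : ∀ s : ℝ, 0 < s → s ≤ r → FiniteDimensional ℂ (pencil A s).ker) :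
    FiniteDimensional ℂ (pencilSpan A r) := by
  have h : pencilSpan A r = ⨆ s : {s : ℝ | 0 < s ∧ s ≤ r ∧ (pencil A s).ker ≠ ⊥},
      (pencil A (s : ℝ)).ker := by
    apply le_antisymm
    · refine iSup₂_le fun s hs => ?_
      by_cases h0 : (pencil A s).ker = ⊥
      · simp [h0]
      · exact le_iSup_of_le ⟨s, hs.1, hs.2, h0⟩ le_rfl
    · exact iSup_le fun s => le_iSup₂_of_le s.1 ⟨s.2.1, s.2.2.1⟩ le_rfl
  rw [h]
  have := hfin.to_subtype
  have : ∀ s : {s : ℝ | 0 < s ∧ s ≤ r ∧ (pencil A s).ker ≠ ⊥},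
      FiniteDimensional ℂ (pencil A (s : ℝ)).ker := fun s => hker s s.2.1 s.2.2.1
  exact Submodule.finiteDimensional_iSup _

variable [CompleteSpace K]

theorem inner_eq_zero_of_mem_ker_pencil (hA : IsSelfAdjoint A) {s t : ℝ} (hst : s ≠ t) {x y : K}
    (hx : x ∈ (pencil A s).ker) (hy : y ∈ (pencil A t).ker) : ⟪x, y⟫_ℂ = 0 := by
  rw [mem_ker_pencil] at hx hy
  have h1 : ⟪x, y⟫_ℂ = s * ⟪x, A y⟫_ℂ := by
    conv_lhs => rw [hx]
    rw [inner_smul_left, inner_apply_comm hA, Complex.conj_ofReal]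
  have h2 : ⟪x, y⟫_ℂ = t * ⟪x, A y⟫_ℂ := by
    conv_lhs => rw [hy]
    rw [inner_smul_right]
  have h3 : ((s : ℂ) - t) * ⟪x, A y⟫_ℂ = 0 := by rw [sub_mul, ← h1, ← h2, sub_self]
  have h4 : (s : ℂ) - t ≠ 0 := sub_ne_zero.mpr (by exact_mod_cast hst)
  rw [h1, (mul_eq_zero.mp h3).resolve_left h4, mul_zero]

/-- On the kernel of `1 - s A` the operator `r A - 1` is the scalar `r / s - 1 ≥ 0`, and kernels for
different `s` are orthogonal, so no cross terms appear. -/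
theorem norm_sq_le_of_mem_pencilSpan (hA : IsSelfAdjoint A) {r : ℝ} {x : K}
    (hx : x ∈ pencilSpan A r) : ‖x‖ ^ 2 ≤ r * (⟪x, A x⟫_ℂ).re := by
  rw [pencilSpan, iSup_subtype', Submodule.mem_iSup_iff_exists_finsupp] at hx
  obtain ⟨f, hf, rfl⟩ := hx
  have hterm : ∀ i : Set.Ioc (0 : ℝ) r,
      (r : ℂ) • A (f i) - f i = ((r / i - 1 : ℝ) : ℂ) • f i := by
    intro i
    have h1 := mem_ker_pencil.mp (hf i)
    have h0 : ((i : ℝ) : ℂ) ≠ 0 := by exact_mod_cast i.2.1.ne'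
    have h2 : A (f i) = ((i : ℝ) : ℂ)⁻¹ • f i := by
      conv_rhs => rw [h1]
      rw [inv_smul_smul₀ h0]
    rw [h2]
    push_cast
    module
  have hsum : (r : ℂ) • A (f.sum fun _ x => x) - (f.sum fun _ x => x) =
      ∑ i ∈ f.support, ((r / i - 1 : ℝ) : ℂ) • f i := by
    simp only [Finsupp.sum, map_sum, Finset.smul_sum, ← Finset.sum_sub_distrib, hterm]
  have hpos : 0 ≤ (⟪f.sum fun _ x => x, (r : ℂ) • A (f.sum fun _ x => x) -
      (f.sum fun _ x => x)⟫_ℂ).re := by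
    rw [hsum, Finsupp.sum, sum_inner, Complex.re_sum]
    refine Finset.sum_nonneg fun i hi => ?_
    rw [inner_sum, Finset.sum_eq_single i]
    · rw [inner_smul_right, inner_self_eq_norm_sq_to_K]
      have : 0 ≤ r / (i : ℝ) - 1 := by
        rw [sub_nonneg, le_div_iff₀ i.2.1, one_mul]
        exact i.2.2
      have h2 : (((r / i - 1 : ℝ) : ℂ) * ((‖f i‖ : ℂ)) ^ 2).re = (r / i - 1) * ‖f i‖ ^ 2 := by
        rw [← Complex.ofReal_pow, ← Complex.ofReal_mul, Complex.ofReal_re]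
      exact (mul_nonneg this (sq_nonneg _)).trans h2.ge
    · intro j _ hji
      rw [inner_smul_right, inner_eq_zero_of_mem_ker_pencil hA (fun h => hji (Subtype.ext h.symm))
        (hf i) (hf j), mul_zero]
    · exact fun h => absurd hi h
  rw [inner_sub_right, inner_smul_right, Complex.sub_re, Complex.re_ofReal_mul, sub_nonneg] at hpos
  refine le_trans (le_of_eq ?_) hpos
  exact (inner_self_eq_norm_sq (𝕜 := ℂ) _).symm

theorem HasLargeSubspace.of_rank_pencilSpan (hA : IsSelfAdjoint A) {k : ℕ} {r : ℝ}
    (h : (k : Cardinal) ≤ Module.rank ℂ (pencilSpan A r)) : HasLargeSubspace A k r :=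
  ⟨_, h, fun _ hx => norm_sq_le_of_mem_pencilSpan hA hx⟩

/-- By selfadjointness a closed range of `1 - s A` is the orthogonal complement of its kernel. The
kernel lies in `Nᗮ`, so the range contains `N`, and the restriction to `N` has no kernel left. -/
theorem isUnit_pencil_of_isClosed_range {N : Submodule ℂ K} [CompleteSpace N] {A₁ : N →L[ℂ] N} {s : ℝ}
    (hA : IsSelfAdjoint A) (hcoe : ∀ x : N, (A₁ x : K) = A x) (horth : ∀ e : K, e ∈ Nᗮ → A e ∈ Nᗮ)
    (hNc : ∀ x : K, ∃ y ∈ N, ∃ z ∈ Nᗮ, x = y + z)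
    (hN : (pencil A s).ker ≤ Nᗮ) (hcl : IsClosed (Set.range (pencil A s))) :
    IsUnit (pencil A₁ s) := by
  rw [ContinuousLinearMap.isUnit_iff_bijective]
  have hco : ∀ x : N, (pencil A₁ s x : K) = pencil A s x := fun x => by simp [hcoe]
  constructor
  · rw [injective_iff_map_eq_zero]
    intro x hx
    have h1 : (x : K) ∈ (pencil A s).ker := by
      rw [LinearMap.mem_ker]
      exact (hco x).symm.trans (by simp [hx])
    exact Subtype.ext (inner_self_eq_zero (𝕜 := ℂ) |>.mp (hN h1 _ x.2))
  · intro y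
    have hy : (y : K) ∈ (pencil A s).range := by
      have hcl' : IsClosed ((pencil A s).range : Set K) := hcl
      have h2 : ((pencil A s).range)ᗮᗮ = (pencil A s).range := by
        rw [Submodule.orthogonal_orthogonal_eq_closure, hcl'.submodule_topologicalClosure_eq]
      rw [← h2]
      intro z hz
      have hz' : z ∈ (pencil A s).ker := by
        rw [LinearMap.mem_ker]
        change pencil A s z = 0
        rw [← inner_self_eq_zero (𝕜 := ℂ), inner_pencil hA, Complex.conj_ofReal,
          ← inner_conj_symm]
        exact (congrArg conj (hz _ ⟨_, rfl⟩)).trans (map_zero _)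
      rw [← inner_conj_symm, hN hz' _ y.2, map_zero]
    obtain ⟨x, hx⟩ := hy
    obtain ⟨a, ha, b, hb, rfl⟩ := hNc x
    refine ⟨⟨a, ha⟩, Subtype.ext ?_⟩
    rw [hco]
    have hx' : pencil A s a + pencil A s b = y := by rw [← map_add]; exact hx
    have ha' : pencil A s a ∈ N := by rw [← hco ⟨a, ha⟩]; exact (pencil A₁ s ⟨a, ha⟩).2
    have hb' : pencil A s b ∈ Nᗮ := by
      rw [pencil_apply]
      exact sub_mem hb (Submodule.smul_mem _ _ (horth b hb))
    -- The part of the solution in `Nᗮ` is mapped into `N` and into `Nᗮ`, hence to zero; the part in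
    -- `N` already solves the equation.
    have hb'' : pencil A s b ∈ N := by
      rw [← eq_sub_iff_add_eq'] at hx'
      rw [hx']
      exact sub_mem y.2 ha'
    have : pencil A s b = 0 := inner_self_eq_zero (𝕜 := ℂ) |>.mp (hb' _ hb'')
    simpa [this] using hx'

/-- For `y ≤ 0` the operator `y - (1 - r A)` is `y - 1` times `1 - s A` with `s = r / (1 - y)` in
`(0, r]`. Thus the spectrum of `1 - r A` is positive, and the functional calculus gives a positive
lower bound. -/
theorem exists_pos_mul_norm_sq_le [Nontrivial K] (hA : IsSelfAdjoint A) {r : ℝ} (hr : 0 < r)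
    (hunit : ∀ s : ℝ, 0 < s → s ≤ r → IsUnit (pencil A s)) :
    ∃ ε : ℝ, 0 < ε ∧ ∀ x, ε * ‖x‖ ^ 2 ≤ ‖x‖ ^ 2 - r * (⟪x, A x⟫_ℂ).re := by
  have hsa : IsSelfAdjoint (1 - r • A) := (IsSelfAdjoint.one _).sub ((IsSelfAdjoint.all r).smul hA)
  have hspec : ∀ y ∈ spectrum ℝ (1 - r • A), 0 < y := by
    intro y hy
    by_contra hy0
    push Not at hy0
    refine hy ?_
    have h1 : 0 < 1 - y := by linarith
    have h2 := hunit (r / (1 - y)) (by positivity) (by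
      rw [div_le_iff₀ h1]; nlinarith)
    have h4 : ((y - 1 : ℝ) : ℂ) * ((r / (1 - y) : ℝ) : ℂ) = -(r : ℂ) := by
      rw [← Complex.ofReal_mul, ← Complex.ofReal_neg]
      congr 1
      field_simp
      ring
    have h3 : (algebraMap ℝ (K →L[ℂ] K)) y - (1 - r • A) =
        (Units.mk0 (y - 1) (by linarith)) • pencil A ((r / (1 - y) : ℝ) : ℂ) := by
      rw [Units.smul_def, Units.val_mk0, Algebra.algebraMap_eq_smul_one]
      refine ContinuousLinearMap.ext fun z => ?_
      have h5 : (y • (1 : K →L[ℂ] K) - (1 - r • A)) z = (y : ℂ) • z - (z - (r : ℂ) • A z) := by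
        simp
      have h6 : ((y - 1) • pencil A ((r / (1 - y) : ℝ) : ℂ)) z =
          ((y - 1 : ℝ) : ℂ) • (z - ((r / (1 - y) : ℝ) : ℂ) • A z) := rfl
      rw [h5, h6, smul_sub, smul_smul, h4]
      push_cast
      module
    rw [resolventSet, Set.mem_ofPred_eq, h3]
    exact h2.smul _
  obtain ⟨ε, hε, hle⟩ := (CFC.exists_pos_algebraMap_le_iff hsa).mpr hspec
  refine ⟨ε, hε, fun x => ?_⟩
  have h6 := ((ContinuousLinearMap.le_def _ _).mp hle).re_inner_nonneg_right x
  have h8 : (1 - r • A - algebraMap ℝ (K →L[ℂ] K) ε) x = x - (r : ℂ) • A x - (ε : ℂ) • x := by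
    simp [Algebra.algebraMap_eq_smul_one]
  have h9 : (⟪x, x⟫_ℂ).re = ‖x‖ ^ 2 := inner_self_eq_norm_sq (𝕜 := ℂ) x
  rw [h8, inner_sub_right, inner_sub_right, inner_smul_right, inner_smul_right] at h6
  simp only [RCLike.re_to_complex, Complex.sub_re, Complex.re_ofReal_mul, h9] at h6
  linarith

/-- The complement of the span reduces `A` and contains no kernel of `1 - s A` with `0 < s ≤ r`, so
`1 - r A` is strictly positive there, which contradicts the inequality for nonzero `x`. -/
theorem eq_zero_of_mem_pencilSpan_orthogonal (hA : IsSelfAdjoint A) {r : ℝ} (hr : 0 < r)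
    (hcl : ∀ s : ℝ, 0 < s → s ≤ r → IsClosed (Set.range (pencil A s)))
    [FiniteDimensional ℂ (pencilSpan A r)] {x : K} (hx : x ∈ (pencilSpan A r)ᗮ)
    (hle : ‖x‖ ^ 2 ≤ r * (⟪x, A x⟫_ℂ).re) : x = 0 := by
  by_contra hx0
  set E := pencilSpan A r with hE
  have hAE : ∀ e ∈ E, A e ∈ E := by
    intro e he
    have : E ≤ E.comap (A : K →ₗ[ℂ] K) := by
      refine iSup₂_le fun s hs e he => ?_
      have h1 : A e ∈ (pencil A s).ker := by
        rw [mem_ker_pencil] at he ⊢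
        rw [← map_smul, ← he]
      exact (le_iSup₂_of_le (f := fun s (_ : s ∈ Set.Ioc (0 : ℝ) r) => (pencil A s).ker)
        s hs le_rfl) h1
    exact this he
  have hAE' : ∀ e ∈ Eᗮ, A e ∈ Eᗮ := by
    intro e he f hf
    rw [← inner_apply_comm hA]
    exact he _ (hAE f hf)
  set A₁ : Eᗮ →L[ℂ] Eᗮ := A.restrict hAE' with hA₁
  have hA₁s : IsSelfAdjoint A₁ := by
    rw [ContinuousLinearMap.isSelfAdjoint_iff_isSymmetric]
    intro y z
    exact inner_apply_comm hA (y : K) z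
  have hEE : Eᗮᗮ = E := Submodule.orthogonal_orthogonal E
  have hunit : ∀ s : ℝ, 0 < s → s ≤ r → IsUnit (pencil A₁ s) := by
    intro s hs hsr
    refine isUnit_pencil_of_isClosed_range hA (fun _ => rfl) (by rwa [hEE]) ?_ ?_ (hcl s hs hsr)
    · intro x
      obtain ⟨e, he, f, hf, rfl⟩ := E.exists_add_mem_mem_orthogonal x
      exact ⟨f, hf, e, by rwa [hEE], add_comm _ _⟩
    · rw [hEE]
      exact le_iSup₂_of_le (f := fun s (_ : s ∈ Set.Ioc (0 : ℝ) r) => (pencil A s).ker)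
        s ⟨hs, hsr⟩ le_rfl
  have : Nontrivial Eᗮ := ⟨⟨⟨x, hx⟩, 0, fun h => hx0 (congrArg Subtype.val h)⟩⟩
  obtain ⟨ε, hε, hle'⟩ := exists_pos_mul_norm_sq_le hA₁s hr hunit
  have h1 : ε * ‖x‖ ^ 2 ≤ ‖x‖ ^ 2 - r * (⟪x, A x⟫_ℂ).re := hle' ⟨x, hx⟩
  have : 0 < ‖x‖ ^ 2 := by positivity
  nlinarith

theorem HasLargeSubspace.le_rank_pencilSpan (hA : IsSelfAdjoint A) {r : ℝ} (hr : 0 < r)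
    (hcl : ∀ s : ℝ, 0 < s → s ≤ r → IsClosed (Set.range (pencil A s)))
    [FiniteDimensional ℂ (pencilSpan A r)] {k : ℕ} (h : HasLargeSubspace A k r) :
    (k : Cardinal) ≤ Module.rank ℂ (pencilSpan A r) := by
  obtain ⟨S, hk, hS⟩ := h
  -- A trial subspace meets the complement of the span only in zero, so orthogonal projection onto
  -- the span is injective on it.
  refine hk.trans (LinearMap.rank_le_of_injective
    ((pencilSpan A r).orthogonalProjectionOnto.toLinearMap ∘ₗ S.subtype) ?_)
  rw [injective_iff_map_eq_zero]
  intro x hx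
  refine Subtype.ext (eq_zero_of_mem_pencilSpan_orthogonal hA hr hcl ?_ (hS x x.2))
  exact (Submodule.orthogonalProjectionOnto_eq_zero_iff).mp hx

open scoped LinearMap.FiniteRangeSetoid in
/-- If `1 - s A` is not Fredholm, then beyond `s` there are large subspaces of all dimensions. -/
theorem isFredholm_pencil_of_not_hasLargeSubspace (hA : IsSelfAdjoint A) {s r : ℝ} (hs : 0 < s)
    (hsr : s < r) {k : ℕ} (h : ¬ HasLargeSubspace A k r) : (pencil A s).IsFredholm := by
  have hsa : IsSelfAdjoint (r • A - 1) := ((IsSelfAdjoint.all r).smul hA).sub (IsSelfAdjoint.one _)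
  set a : K →L[ℂ] K := r • A - 1 with ha
  have hdec : a⁺ - a⁻ = a := CFC.posPart_sub_negPart a hsa
  have hap : a * a⁺ = a⁺ * a⁺ := by
    have h1 : a * a⁺ = (a⁺ - a⁻) * a⁺ := by rw [hdec]
    rw [h1, sub_mul, CFC.negPart_mul_posPart, sub_zero]
  -- The form of `a = r A - 1` is nonnegative on the range of `a⁺`, since `a a⁺ = a⁺ a⁺`. An
  -- infinite-dimensional range would be a trial subspace for every `k`.
  have hfin : FiniteDimensional ℂ (a⁺ : K →L[ℂ] K).range := by
    by_contra hinf
    refine h ⟨(a⁺ : K →L[ℂ] K).range, ?_, ?_⟩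
    · refine (Cardinal.natCast_le_aleph0).trans ?_
      by_contra hlt
      push Not at hlt
      exact hinf (Module.rank_lt_aleph0_iff.mp hlt)
    · rintro _ ⟨x, rfl⟩
      change ‖a⁺ x‖ ^ 2 ≤ r * (⟪a⁺ x, A (a⁺ x)⟫_ℂ).re
      have h1 : a (a⁺ x) = a⁺ (a⁺ x) := by
        simpa using congrArg (fun T : K →L[ℂ] K => T x) hap
      have h2 : 0 ≤ (⟪a⁺ x, a (a⁺ x)⟫_ℂ).re := by
        rw [h1]
        exact ((ContinuousLinearMap.nonneg_iff_isPositive _).mp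
          (CFC.posPart_nonneg a)).re_inner_nonneg_right _
      have h3 : a (a⁺ x) = (r : ℂ) • A (a⁺ x) - a⁺ x := by simp [ha]
      rw [h3, inner_sub_right, inner_smul_right, Complex.sub_re, Complex.re_ofReal_mul,
        sub_nonneg] at h2
      refine le_trans (le_of_eq ?_) h2
      exact (inner_self_eq_norm_sq (𝕜 := ℂ) _).symm
  have hr : 0 < r := hs.trans hsr
  -- With this `c`, `1 - s A = (1 - c) - c a = U - c a⁺`, where `U = (1 - c) + c a⁻ ≥ 1 - c > 0` is
  -- invertible. So `1 - s A` is invertible up to finite rank.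
  set c : ℝ := s / r with hc
  have hc0 : 0 < c := by positivity
  have hc1 : c < 1 := by rw [hc, div_lt_one hr]; exact hsr
  set U : K →L[ℂ] K := ((1 - c : ℝ) : ℂ) • 1 + (c : ℂ) • a⁻ with hU
  have hUunit : IsUnit U := by
    have hcc : 0 < (1 - c).toNNReal := Real.toNNReal_pos.mpr (by linarith)
    refine ContinuousLinearMap.isUnit_of_forall_le_norm_inner_map U hcc fun x => ?_
    refine le_trans ?_ (Complex.re_le_norm _)
    have h1 : 0 ≤ (⟪a⁻ x, x⟫_ℂ).re := ((ContinuousLinearMap.nonneg_iff_isPositive _).mp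
      (CFC.negPart_nonneg a)).re_inner_nonneg_left x
    have h2 : (⟪x, x⟫_ℂ).re = ‖x‖ ^ 2 := inner_self_eq_norm_sq (𝕜 := ℂ) x
    have h3 : (⟪U x, x⟫_ℂ).re = (1 - c) * ‖x‖ ^ 2 + c * (⟪a⁻ x, x⟫_ℂ).re := by
      rw [← h2, ← Complex.re_ofReal_mul, ← Complex.re_ofReal_mul, ← Complex.add_re]
      simp [hU, mul_comm]
    rw [h3, Real.coe_toNNReal _ (by linarith)]
    nlinarith
  have hdecU : pencil A s = U - (c : ℂ) • a⁺ := by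
    have h1 : a⁻ = a⁺ - a := by rw [eq_sub_iff_add_eq, ← eq_sub_iff_add_eq', hdec]
    have h2 : (c : ℂ) * (r : ℂ) = s := by
      rw [← Complex.ofReal_mul, hc, div_mul_cancel₀ _ hr.ne']
    ext x
    have h3 : a x = (r : ℂ) • A x - x := by simp [ha]
    rw [hU, h1]
    simp only [pencil_apply, sub_apply, add_apply,
      smul_apply, one_apply_eq_self, h3, ← h2]
    push_cast
    module
  obtain ⟨u, hu⟩ := hUunit
  have hap0 : ((pencil A s : K →L[ℂ] K) : K →ₗ[ℂ] K) ≈ ((u : K →L[ℂ] K) : K →ₗ[ℂ] K) := by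
    rw [LinearMap.FiniteRangeSetoid.equiv_iff_hasFiniteRange, hdecU, hu]
    have h1 : ((U - (c : ℂ) • a⁺ : K →L[ℂ] K) : K →ₗ[ℂ] K) - U =
        (-(c : ℂ)) • ((a⁺ : K →L[ℂ] K) : K →ₗ[ℂ] K) := by
      ext x
      simp
    rw [h1]
    exact LinearMap.HasFiniteRange.smul (Submodule.FG.of_finite) _
  refine ContinuousLinearMap.IsFredholm.of_isQuasiInverse (v := ↑u⁻¹) ?_
  have h0 : ((↑u⁻¹ : K →L[ℂ] K) : K →ₗ[ℂ] K).IsQuasiInverse ((u : K →L[ℂ] K) : K →ₗ[ℂ] K) := by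
    have h1 : ((↑u⁻¹ : K →L[ℂ] K) : K →ₗ[ℂ] K) ∘ₗ ((u : K →L[ℂ] K) : K →ₗ[ℂ] K) = .id :=
      congrArg ContinuousLinearMap.toLinearMap u.inv_mul
    have h2 : ((u : K →L[ℂ] K) : K →ₗ[ℂ] K) ∘ₗ ((↑u⁻¹ : K →L[ℂ] K) : K →ₗ[ℂ] K) = .id :=
      congrArg ContinuousLinearMap.toLinearMap u.mul_inv
    exact ⟨by rw [LinearMap.IsLeftQuasiInverse, h1], by rw [LinearMap.IsRightQuasiInverse, h2]⟩
  exact h0.congr (Setoid.refl _) hap0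

end Variational

/-! ### Exchanging the factors: `1 - z P Q` and `1 - z Q P` -/

section Factorization

variable {K X : Type*} [NormedAddCommGroup K] [InnerProductSpace ℂ K]
  [NormedAddCommGroup X] [InnerProductSpace ℂ X] {P : K →L[ℂ] X} {Q : X →L[ℂ] K}

theorem ker_pencil_comp (P : K →L[ℂ] X) (Q : X →L[ℂ] K) (z : ℂ) :
    (pencil (P ∘L Q) z).ker = (pencil (Q ∘L P) z).ker.map (P : K →ₗ[ℂ] X) := by
  ext x
  simp only [Submodule.mem_map, mem_ker_pencil, ContinuousLinearMap.comp_apply,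
    ContinuousLinearMap.coe_coe]
  constructor
  · intro h
    refine ⟨z • Q x, ?_, ?_⟩
    · have h1 : Q x = z • Q (P (Q x)) := by rw [← map_smul, ← h]
      rw [map_smul, map_smul, ← h1]
    · rw [map_smul, ← h]
  · rintro ⟨y, h, rfl⟩
    rw [← map_smul, ← h]

/-- The range of `1 - z Q P` is the preimage under `P` of the range of `1 - z P Q`. -/
theorem isClosed_range_pencil_comp {z : ℂ} (h : IsClosed (Set.range (pencil (P ∘L Q) z))) :
    IsClosed (Set.range (pencil (Q ∘L P) z)) := by
  have heq : Set.range (pencil (Q ∘L P) z) = P ⁻¹' Set.range (pencil (P ∘L Q) z) := by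
    ext y
    constructor
    · rintro ⟨w, rfl⟩
      exact ⟨P w, by simp⟩
    · rintro ⟨x, hx⟩
      refine ⟨y + z • Q x, ?_⟩
      have : P y = x - z • P (Q x) := hx.symm
      simp [this]
  rw [heq]
  exact h.preimage P.continuous

/-- An inverse `V` of `1 - z Q P` yields the inverse `1 + z P V Q` of `1 - z P Q`. Keeping the
defect explicit makes the identity usable also for inverses modulo finite rank. -/
theorem pencil_comp_mul (P : K →L[ℂ] X) (Q : X →L[ℂ] K) (z : ℂ) (V : K →L[ℂ] K) :
    pencil (P ∘L Q) z * (1 + z • P ∘L V ∘L Q) =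
      1 + z • P ∘L (pencil (Q ∘L P) z * V - 1) ∘L Q := by
  ext x
  simp [smul_sub]
  abel

theorem mul_pencil_comp (P : K →L[ℂ] X) (Q : X →L[ℂ] K) (z : ℂ) (V : K →L[ℂ] K) :
    (1 + z • P ∘L V ∘L Q) * pencil (P ∘L Q) z =
      1 + z • P ∘L (V * pencil (Q ∘L P) z - 1) ∘L Q := by
  ext x
  simp [smul_sub]
  abel

theorem isUnit_pencil_comp {z : ℂ} (h : IsUnit (pencil (Q ∘L P) z)) :
    IsUnit (pencil (P ∘L Q) z) := by
  obtain ⟨u, hu⟩ := h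
  refine isUnit_iff_exists.mpr ⟨1 + z • P ∘L (↑u⁻¹ : K →L[ℂ] K) ∘L Q, ?_, ?_⟩
  · rw [pencil_comp_mul, ← hu, u.mul_inv]
    simp
  · rw [mul_pencil_comp, ← hu, u.inv_mul]
    simp

-- A defect of finite rank keeps finite rank when it is placed between `P` and `Q`.
open scoped LinearMap.FiniteRangeSetoid in
theorem isFredholm_pencil_comp {z : ℂ} (h : (pencil (Q ∘L P) z).IsFredholm) :
    (pencil (P ∘L Q) z).IsFredholm := by
  obtain ⟨V, hl, hr⟩ := h.exists_isQuasiInverse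
  have key : ∀ W : K →L[ℂ] K, (W : K →ₗ[ℂ] K) ≈ .id →
      ((1 + z • P ∘L (W - 1) ∘L Q : X →L[ℂ] X) : X →ₗ[ℂ] X) ≈ .id := by
    intro W hW
    rw [LinearMap.FiniteRangeSetoid.equiv_iff_hasFiniteRange] at hW ⊢
    have h1 : ((1 + z • P ∘L (W - 1) ∘L Q : X →L[ℂ] X) : X →ₗ[ℂ] X) - .id =
        z • (P : K →ₗ[ℂ] X) ∘ₗ ((W : K →ₗ[ℂ] K) - .id) ∘ₗ (Q : X →ₗ[ℂ] K) := by
      ext x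
      simp
    rw [h1]
    exact ((hW.comp_right _).comp_left _).smul z
  refine .of_isQuasiInverse (v := 1 + z • P ∘L V ∘L Q) ⟨?_, ?_⟩
  · have := key (V * pencil (Q ∘L P) z) hl
    rwa [← mul_pencil_comp] at this
  · have := key (pencil (Q ∘L P) z * V) hr
    rwa [← pencil_comp_mul] at this

end Factorization

/-! ### Spectral data of an unbounded operator with bounded inverse -/

section InverseGraph

variable {X : Type*} [NormedAddCommGroup X] [InnerProductSpace ℂ X]
  {T : X →ₗ.[ℂ] X} {B : X →L[ℂ] X}

/-- `T` is the inverse of the everywhere defined operator `B`. -/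
def IsInverseOf (T : X →ₗ.[ℂ] X) (B : X →L[ℂ] X) : Prop :=
  ∀ x y : X, (x, y) ∈ T.graph ↔ x = B y

theorem shift_apply (T : X →ₗ.[ℂ] X) (z : ℂ) (ψ : T.domain) : shift T z ψ = T ψ - z • (ψ : X) := rfl

theorem IsInverseOf.apply_eq (h : IsInverseOf T B) (ψ : T.domain) : (ψ : X) = B (T ψ) :=
  (h _ _).mp (T.mem_graph ψ)

theorem IsInverseOf.exists_apply_eq (h : IsInverseOf T B) (y : X) :
    ∃ ψ : T.domain, (ψ : X) = B y ∧ T ψ = y := by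
  simpa using (h (B y) y).mpr rfl

/-- On the domain `T - z = (1 - z B) T`, and `T` maps its domain onto the whole space. -/
theorem IsInverseOf.range_shift (h : IsInverseOf T B) (z : ℂ) :
    LinearMap.range (shift T z) = (pencil B z).range := by
  ext y
  constructor
  · rintro ⟨ψ, rfl⟩
    exact ⟨T ψ, by simp [shift_apply, ← h.apply_eq ψ]⟩
  · rintro ⟨x, rfl⟩
    obtain ⟨ψ, h1, h2⟩ := h.exists_apply_eq x
    exact ⟨ψ, by simp [shift_apply, h1, h2]⟩

theorem IsInverseOf.eigenspace_eq (h : IsInverseOf T B) (z : ℂ) :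
    eigenspace T z = (pencil B z).ker := by
  ext x
  rw [mem_ker_pencil]
  constructor
  · rintro ⟨ψ, h1, rfl⟩
    have h2 : T ψ = z • (ψ : X) := sub_eq_zero.mp h1
    simp only [Submodule.subtype_apply]
    rw [← map_smul, ← h2, ← h.apply_eq ψ]
  · intro hx
    obtain ⟨ψ, h1, h2⟩ := h.exists_apply_eq (z • x)
    rw [map_smul, ← hx] at h1
    exact ⟨ψ, by simp [shift_apply, h1, h2], h1⟩

theorem IsInverseOf.inResolventSet (h : IsInverseOf T B) {z : ℂ} (hu : IsUnit (pencil B z)) :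
    InResolventSet T z := by
  obtain ⟨u, hu⟩ := hu
  have hl : ∀ x, (↑u⁻¹ : X →L[ℂ] X) (pencil B z x) = x := fun x => by
    rw [← hu]
    exact congrArg (fun S : X →L[ℂ] X => S x) u.inv_mul
  have hr : ∀ x, pencil B z ((↑u⁻¹ : X →L[ℂ] X) x) = x := fun x => by
    rw [← hu]
    exact congrArg (fun S : X →L[ℂ] X => S x) u.mul_inv
  -- The resolvent is `B (1 - z B)⁻¹`.
  refine ⟨B ∘L ↑u⁻¹, fun ψ => ?_, fun x => ?_⟩
  · have : shift T z ψ = pencil B z (T ψ) := by simp [shift_apply, ← h.apply_eq ψ]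
    rw [this, ContinuousLinearMap.comp_apply, hl, ← h.apply_eq]
  · obtain ⟨ψ, h1, h2⟩ := h.exists_apply_eq ((↑u⁻¹ : X →L[ℂ] X) x)
    refine ⟨ψ, h1, ?_⟩
    rw [shift_apply, h1, h2]
    exact hr x

theorem IsInverseOf.isFredholmAt (h : IsInverseOf T B) {z : ℂ} (hF : (pencil B z).IsFredholm) :
    IsFredholmAt T z := by
  refine ⟨?_, ?_, ?_⟩
  · have := hF.finite_ker
    rw [← h.eigenspace_eq, eigenspace] at this
    exact (Submodule.equivMapOfInjective T.domain.subtype T.domain.injective_subtype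
      (LinearMap.ker (shift T z))).symm.finiteDimensional
  · rw [h.range_shift]
    exact hF.isClosed_range
  · rw [h.range_shift]
    exact hF.finite_coker

theorem IsInverseOf.isClosed_range (h : IsInverseOf T B) {z : ℂ} (hF : IsFredholmAt T z) :
    IsClosed (Set.range (pencil B z)) := by
  have := hF.2.1
  rwa [h.range_shift] at this

theorem IsFredholmAt.finiteDimensional_eigenspace {z : ℂ} (hF : IsFredholmAt T z) :
    FiniteDimensional ℂ (eigenspace T z) := by
  have := hF.1
  exact Module.Finite.map _ _

/-- Makes the independence of eigenspaces of the everywhere defined `B` available for `T`. -/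
theorem IsInverseOf.eigenspace_eq_eigenspace (h : IsInverseOf T B) {z : ℂ} (hz : z ≠ 0) :
    eigenspace T z = Module.End.eigenspace (B : X →ₗ[ℂ] X) z⁻¹ := by
  ext x
  rw [h.eigenspace_eq, mem_ker_pencil, Module.End.mem_eigenspace_iff, ContinuousLinearMap.coe_coe,
    eq_inv_smul_iff₀ hz, eq_comm]

/-- The span of the eigenspaces to the eigenvalues in `(0, r]`. -/
def eigenSpan (T : X →ₗ.[ℂ] X) (r : ℝ) : Submodule ℂ X :=
  ⨆ s ∈ Set.Ioc (0 : ℝ) r, eigenspace T (s : ℂ)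

theorem eigenSpan_mono (T : X →ₗ.[ℂ] X) {r r' : ℝ} (h : r ≤ r') :
    eigenSpan T r ≤ eigenSpan T r' :=
  biSup_mono fun _ hs => ⟨hs.1, hs.2.trans h⟩

theorem eigenspace_le_eigenSpan (T : X →ₗ.[ℂ] X) {s r : ℝ} (hs : 0 < s) (h : s ≤ r) :
    eigenspace T (s : ℂ) ≤ eigenSpan T r :=
  le_iSup₂_of_le (f := fun s (_ : s ∈ Set.Ioc (0 : ℝ) r) => eigenspace T (s : ℂ)) s ⟨hs, h⟩ le_rfl

theorem IsInverseOf.disjoint_eigenSpan (h : IsInverseOf T B) {r l : ℝ} (hl : 0 < l) (hr : r < l) :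
    Disjoint (eigenSpan T r) (eigenspace T (l : ℂ)) := by
  have h1 := (Module.End.eigenspaces_iSupIndep (B : X →ₗ[ℂ] X) ((l : ℂ)⁻¹)).symm
  rw [← h.eigenspace_eq_eigenspace (by exact_mod_cast hl.ne')] at h1
  refine h1.mono_left (iSup₂_le fun s hs => ?_)
  rw [h.eigenspace_eq_eigenspace (by exact_mod_cast hs.1.ne')]
  refine le_iSup₂_of_le (f := fun j (_ : j ≠ (l : ℂ)⁻¹) =>
    Module.End.eigenspace (B : X →ₗ[ℂ] X) j) _ ?_ le_rfl
  rw [ne_eq, inv_inj, Complex.ofReal_inj]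
  exact (hs.2.trans_lt hr).ne

theorem eigPos_lt_iff {k : ℕ} {x : EReal} : eigPos T k < x ↔ sigmaPos T < x ∨
    ∃ r : ℝ, 0 < r ∧ (r : EReal) < sigmaPos T ∧ (r : EReal) < x ∧
      (k : Cardinal) ≤ Module.rank ℂ (eigenSpan T r) := by
  rw [eigPos, sInf_lt_iff]
  constructor
  · rintro ⟨t, rfl | ⟨r, rfl, h1, h2, h3⟩, hx⟩
    · exact .inl hx
    · exact .inr ⟨r, h1, h2, hx, h3⟩
  · rintro (h | ⟨r, h1, h2, hx, h3⟩)
    · exact ⟨_, .inl rfl, h⟩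
    · exact ⟨r, .inr ⟨r, rfl, h1, h2, h3⟩, hx⟩

theorem eigPos_le_sigmaPos (T : X →ₗ.[ℂ] X) (k : ℕ) : eigPos T k ≤ sigmaPos T :=
  sInf_le (.inl rfl)

theorem eigPos_le {k : ℕ} {r : ℝ} (h1 : 0 < r) (h2 : (r : EReal) < sigmaPos T)
    (h3 : (k : Cardinal) ≤ Module.rank ℂ (eigenSpan T r)) : eigPos T k ≤ r :=
  sInf_le (.inr ⟨r, rfl, h1, h2, h3⟩)

theorem eigPos_mono (T : X →ₗ.[ℂ] X) {j k : ℕ} (h : j ≤ k) : eigPos T j ≤ eigPos T k := by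
  refine sInf_le_sInf (Set.union_subset_union_right _ ?_)
  rintro t ⟨r, h0, h1, h2, h3⟩
  exact ⟨r, h0, h1, h2, le_trans (by exact_mod_cast h) h3⟩

theorem isFredholmAt_of_lt_sigmaPos {s : ℝ} (hs : 0 < s) (h : (s : EReal) < sigmaPos T) :
    IsFredholmAt T (s : ℂ) := by
  by_contra hF
  have h1 : sigmaPos T ≤ s := sInf_le ⟨s, rfl, hs, hF⟩
  exact h1.not_gt h

/-- An eigenvalue below `sigmaPos T` occurs in the sequence `eigPos T` according to its
multiplicity. -/
theorem IsInverseOf.ncard_eigPos_eq (h : IsInverseOf T B)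
    (hfin : ∀ r : ℝ, (r : EReal) < sigmaPos T →
      {s : ℝ | 0 < s ∧ s ≤ r ∧ eigenspace T (s : ℂ) ≠ ⊥}.Finite)
    (hfd : ∀ r : ℝ, (r : EReal) < sigmaPos T → FiniteDimensional ℂ (eigenSpan T r))
    {l : ℝ} (hl : 0 < l) (hlσ : (l : EReal) < sigmaPos T) :
    {i : ℕ | 1 ≤ i ∧ eigPos T i = l}.ncard = Module.finrank ℂ (eigenspace T (l : ℂ)) := by
  obtain ⟨r₁, hr₁, hr₁σ⟩ := EReal.lt_iff_exists_real_btwn.mp hlσ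
  rw [EReal.coe_lt_coe_iff] at hr₁
  have hfin₁ := (hfin r₁ hr₁σ).subset (Set.sdiff_subset (t := {l}))
  obtain ⟨ε, hε, hball⟩ := Metric.mem_nhds_iff.mp
    (hfin₁.isClosed.isOpen_compl.mem_nhds (x := l) (by simp))
  have hbot : ∀ s : ℝ, 0 < s → s ≤ r₁ → s ≠ l → |s - l| < ε → eigenspace T (s : ℂ) = ⊥ := by
    intro s h0 h1 h2 h3
    by_contra h4
    exact hball (Metric.mem_ball.mpr h3) ⟨⟨h0, h1, h4⟩, h2⟩
  -- A positive number just below `l` with no eigenvalue strictly between; `l / 2` only secures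
  -- positivity.
  set r₀ : ℝ := max (l - ε / 2) (l / 2) with hr₀
  have hr₀0 : 0 < r₀ := lt_max_of_lt_right (by linarith)
  have hr₀l : r₀ < l := max_lt (by linarith) (by linarith)
  have hr₀ε : l - ε / 2 ≤ r₀ := le_max_left _ _
  have hlow : ∀ r : ℝ, r < l → eigenSpan T r ≤ eigenSpan T r₀ := by
    intro r hr
    refine iSup₂_le fun s hs => ?_
    rcases le_or_gt s r₀ with h1 | h1
    · exact eigenspace_le_eigenSpan T hs.1 h1
    · have h2 := hs.2
      rw [hbot s hs.1 (by linarith) (by linarith) (by rw [abs_lt]; constructor <;> linarith)]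
      exact bot_le
  have hhigh : ∀ r : ℝ, r ≤ r₁ → r < l + ε → eigenSpan T r ≤ eigenSpan T l := by
    intro r hr hrε
    refine iSup₂_le fun s hs => ?_
    rcases le_or_gt s l with h1 | h1
    · exact eigenspace_le_eigenSpan T hs.1 h1
    · have h2 := hs.2
      rw [hbot s hs.1 (by linarith) (by linarith) (by rw [abs_lt]; constructor <;> linarith)]
      exact bot_le
  have hsup : eigenSpan T l = eigenSpan T r₀ ⊔ eigenspace T (l : ℂ) := by
    apply le_antisymm
    · refine iSup₂_le fun s hs => ?_
      rcases hs.2.eq_or_lt with rfl | h1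
      · exact le_sup_right
      · exact le_sup_of_le_left ((eigenspace_le_eigenSpan T hs.1 le_rfl).trans (hlow s h1))
    · exact sup_le (eigenSpan_mono T hr₀l.le) (eigenspace_le_eigenSpan T hl le_rfl)
  have hr₀σ : (r₀ : EReal) < sigmaPos T := lt_trans (by exact_mod_cast hr₀l) hlσ
  have := hfd l hlσ
  have := hfd r₀ hr₀σ
  have : FiniteDimensional ℂ (eigenspace T (l : ℂ)) :=
    (isFredholmAt_of_lt_sigmaPos hl hlσ).finiteDimensional_eigenspace
  have hdim : Module.finrank ℂ (eigenSpan T l) =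
      Module.finrank ℂ (eigenSpan T r₀) + Module.finrank ℂ (eigenspace T (l : ℂ)) := by
    have h1 := Submodule.finrank_sup_add_finrank_inf_eq (eigenSpan T r₀) (eigenspace T (l : ℂ))
    rw [(h.disjoint_eigenSpan hl hr₀l).eq_bot, finrank_bot, add_zero, ← hsup] at h1
    exact h1
  -- The value `l` is taken exactly at the indices above the number of eigenvalues below `l` and up
  -- to the number of those not exceeding `l`, counted with multiplicity.
  have hset : {i : ℕ | 1 ≤ i ∧ eigPos T i = l} = Finset.Ioc (Module.finrank ℂ (eigenSpan T r₀))
      (Module.finrank ℂ (eigenSpan T l)) := by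
    ext i
    have hrank : ∀ r : ℝ, FiniteDimensional ℂ (eigenSpan T r) →
        ((i : Cardinal) ≤ Module.rank ℂ (eigenSpan T r) ↔
          i ≤ Module.finrank ℂ (eigenSpan T r)) := by
      intro r _
      rw [← Module.finrank_eq_rank, Nat.cast_le]
    simp only [Set.mem_ofPred_eq, Finset.coe_Ioc, Set.mem_Ioc]
    constructor
    · rintro ⟨-, hi⟩
      constructor
      · by_contra! h1
        have h2 := eigPos_le hr₀0 hr₀σ ((hrank r₀ inferInstance).mpr h1)
        rw [hi, EReal.coe_le_coe_iff] at h2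
        linarith
      · have h1 : eigPos T i < (min (l + ε) r₁ : ℝ) := by
          rw [hi, EReal.coe_lt_coe_iff]
          exact lt_min (by linarith) hr₁
        rcases eigPos_lt_iff.mp h1 with h2 | ⟨r, -, -, h3, h4⟩
        · exact absurd (h2.trans_le (by exact_mod_cast min_le_right _ _)) hr₁σ.not_gt
        · rw [EReal.coe_lt_coe_iff, lt_min_iff] at h3
          exact (hrank l inferInstance).mp (h4.trans (Submodule.rank_mono (hhigh r h3.2.le h3.1)))
    · rintro ⟨h1, h2⟩
      refine ⟨by omega, le_antisymm (eigPos_le hl hlσ ((hrank l inferInstance).mpr h2)) ?_⟩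
      by_contra! h3
      rcases eigPos_lt_iff.mp h3 with h4 | ⟨r, -, -, h4, h5⟩
      · exact h4.not_gt hlσ
      · rw [EReal.coe_lt_coe_iff] at h4
        exact h1.not_ge ((hrank r₀ inferInstance).mp
          (h5.trans (Submodule.rank_mono (hlow r h4))))
  rw [hset, Set.ncard_coe_finset, Nat.card_Ioc, hdim]
  omega

end InverseGraph

/-! ### Eigenvalues of `(P Q)⁻¹` through the selfadjoint operator `Q P` -/

section Model

universe u

variable {K X : Type u} [NormedAddCommGroup K] [InnerProductSpace ℂ K]
  [NormedAddCommGroup X] [InnerProductSpace ℂ X] {P : K →L[ℂ] X} {Q : X →L[ℂ] K}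
  {T : X →ₗ.[ℂ] X}

theorem IsInverseOf.eigenSpan_eq_map (hT : IsInverseOf T (P ∘L Q)) (r : ℝ) :
    eigenSpan T r = (pencilSpan (Q ∘L P) r).map (P : K →ₗ[ℂ] X) := by
  simp only [eigenSpan, pencilSpan, Submodule.map_iSup, hT.eigenspace_eq, ker_pencil_comp P Q]

theorem IsInverseOf.rank_eigenSpan (hT : IsInverseOf T (P ∘L Q)) (hP : Function.Injective P)
    (r : ℝ) : Module.rank ℂ (eigenSpan T r) = Module.rank ℂ (pencilSpan (Q ∘L P) r) := by
  rw [hT.eigenSpan_eq_map]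
  exact (Submodule.equivMapOfInjective (P : K →ₗ[ℂ] X) hP (pencilSpan (Q ∘L P) r)).rank_eq.symm

theorem IsInverseOf.isClosed_range_pencil (hT : IsInverseOf T (P ∘L Q)) {s : ℝ} (hs : 0 < s)
    (h : (s : EReal) < sigmaPos T) : IsClosed (Set.range (pencil (Q ∘L P) s)) :=
  isClosed_range_pencil_comp (hT.isClosed_range (isFredholmAt_of_lt_sigmaPos hs h))

theorem HasLargeSubspace.mono {A : K →L[ℂ] K} {k : ℕ} {r r' : ℝ} (h : HasLargeSubspace A k r)
    (hr : 0 < r) (hrr' : r ≤ r') : HasLargeSubspace A k r' := by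
  obtain ⟨S, hk, hS⟩ := h
  refine ⟨S, hk, fun x hx => (hS x hx).trans ?_⟩
  have : 0 ≤ (⟪x, A x⟫_ℂ).re := nonneg_of_mul_nonneg_right ((sq_nonneg _).trans (hS x hx)) hr
  gcongr

/-- One nonzero trial vector suffices. This keeps the positive eigenvalues away from zero. -/
theorem HasLargeSubspace.one_le_mul_norm {A : K →L[ℂ] K} {k : ℕ} (hk : 1 ≤ k) {r : ℝ}
    (hr : 0 ≤ r) (h : HasLargeSubspace A k r) : 1 ≤ r * ‖A‖ := by
  obtain ⟨S, hkS, hS⟩ := h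
  have : Nontrivial S := by
    rw [← rank_pos_iff_nontrivial (R := ℂ)]
    exact lt_of_lt_of_le (by exact_mod_cast hk) hkS
  obtain ⟨x, hx⟩ := exists_ne (0 : S)
  have hx0 : 0 < ‖(x : K)‖ := norm_pos_iff.mpr (by simpa using hx)
  have h1 : (⟪(x : K), A x⟫_ℂ).re ≤ ‖(x : K)‖ * (‖A‖ * ‖(x : K)‖) :=
    (Complex.re_le_norm _).trans ((norm_inner_le_norm _ _).trans (by gcongr; exact A.le_opNorm _))
  have h2 := (hS x x.2).trans (mul_le_mul_of_nonneg_left h1 hr)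
  have h3 : 0 < ‖(x : K)‖ ^ 2 := by positivity
  nlinarith

variable [CompleteSpace K]

theorem IsInverseOf.finite_setOf_eigenspace_ne_bot (hT : IsInverseOf T (P ∘L Q))
    (hA : IsSelfAdjoint (Q ∘L P)) {r : ℝ} (hr : (r : EReal) < sigmaPos T) :
    {s : ℝ | 0 < s ∧ s ≤ r ∧ eigenspace T (s : ℂ) ≠ ⊥}.Finite := by
  refine (finite_setOf_ker_pencil_ne_bot hA r fun s h0 h1 =>
    hT.isClosed_range_pencil h0 (lt_of_le_of_lt (by exact_mod_cast h1) hr)).subset ?_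
  rintro s ⟨h0, h1, h2⟩
  refine ⟨h0, h1, fun h3 => h2 ?_⟩
  rw [hT.eigenspace_eq, ker_pencil_comp, h3, Submodule.map_bot]

theorem IsInverseOf.finiteDimensional_pencilSpan (hT : IsInverseOf T (P ∘L Q))
    (hA : IsSelfAdjoint (Q ∘L P)) (hP : Function.Injective P) {r : ℝ}
    (hr : (r : EReal) < sigmaPos T) : FiniteDimensional ℂ (pencilSpan (Q ∘L P) r) := by
  refine KreinPerturbation.finiteDimensional_pencilSpan
    (finite_setOf_ker_pencil_ne_bot hA r fun s h0 h1 =>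
      hT.isClosed_range_pencil h0 (lt_of_le_of_lt (by exact_mod_cast h1) hr)) fun s h0 h1 => ?_
  have := (isFredholmAt_of_lt_sigmaPos (T := T) h0
    (lt_of_le_of_lt (by exact_mod_cast h1) hr)).finiteDimensional_eigenspace
  rw [hT.eigenspace_eq, ker_pencil_comp] at this
  exact (Submodule.equivMapOfInjective (P : K →ₗ[ℂ] X) hP _).symm.finiteDimensional

theorem IsInverseOf.finiteDimensional_eigenSpan (hT : IsInverseOf T (P ∘L Q))
    (hA : IsSelfAdjoint (Q ∘L P)) (hP : Function.Injective P) {r : ℝ}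
    (hr : (r : EReal) < sigmaPos T) : FiniteDimensional ℂ (eigenSpan T r) := by
  have := hT.finiteDimensional_pencilSpan hA hP hr
  rw [hT.eigenSpan_eq_map]
  exact Module.Finite.map _ _

/-- Below `r` there is either a point of the essential spectrum, where the pencil is not Fredholm
and trial subspaces of every dimension exist, or a span of eigenvectors of sufficient dimension. -/
theorem IsInverseOf.hasLargeSubspace_of_eigPos_lt (hT : IsInverseOf T (P ∘L Q))
    (hA : IsSelfAdjoint (Q ∘L P)) (hP : Function.Injective P) {k : ℕ} {r : ℝ}
    (h : eigPos T k < r) : HasLargeSubspace (Q ∘L P) k r := by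
  rcases eigPos_lt_iff.mp h with h1 | ⟨s, h0, -, h1, h2⟩
  · rw [sigmaPos, sInf_lt_iff] at h1
    obtain ⟨_, ⟨s, rfl, hs, hess⟩, hsr⟩ := h1
    by_contra hL
    exact hess (hT.isFredholmAt (isFredholm_pencil_comp
      (isFredholm_pencil_of_not_hasLargeSubspace hA hs (by exact_mod_cast hsr) hL)))
  · rw [hT.rank_eigenSpan hP] at h2
    exact (HasLargeSubspace.of_rank_pencilSpan hA h2).mono h0 (by exact_mod_cast h1.le)

/-- Only `r < σ⁺` needs an argument: there the ranges are closed and the eigenvector span is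
finite-dimensional, so its dimension bounds that of every trial subspace. -/
theorem IsInverseOf.eigPos_le_of_hasLargeSubspace (hT : IsInverseOf T (P ∘L Q))
    (hA : IsSelfAdjoint (Q ∘L P)) (hP : Function.Injective P) {k : ℕ} {r : ℝ} (hr : 0 < r)
    (h : HasLargeSubspace (Q ∘L P) k r) : eigPos T k ≤ r := by
  rcases le_or_gt (sigmaPos T) r with h1 | h1
  · exact (eigPos_le_sigmaPos T k).trans h1
  · have := hT.finiteDimensional_pencilSpan hA hP h1
    refine eigPos_le hr h1 ?_
    rw [hT.rank_eigenSpan hP]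
    exact h.le_rank_pencilSpan hA hr fun s h0 h2 =>
      hT.isClosed_range_pencil h0 (lt_of_le_of_lt (by exact_mod_cast h2) h1)

theorem IsInverseOf.eigPos_pos (hT : IsInverseOf T (P ∘L Q))
    (hA : IsSelfAdjoint (Q ∘L P)) (hP : Function.Injective P) {k : ℕ} (hk : 1 ≤ k) :
    0 < eigPos T k := by
  set c : ℝ := (‖Q ∘L P‖ + 1)⁻¹ with hc
  have hn : 0 < ‖Q ∘L P‖ + 1 := by positivity
  have hc0 : 0 < c := by positivity
  refine lt_of_lt_of_le (b := (c : EReal)) (by exact_mod_cast hc0) ?_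
  by_contra! h
  have h1 := (hT.hasLargeSubspace_of_eigPos_lt hA hP h).one_le_mul_norm hk hc0.le
  have h2 : c * (‖Q ∘L P‖ + 1) = 1 := inv_mul_cancel₀ hn.ne'
  nlinarith

theorem IsInverseOf.exists_inResolventSet_near (hT : IsInverseOf T (P ∘L Q))
    (hA : IsSelfAdjoint (Q ∘L P)) {l : ℝ} (hl : 0 < l) (h : (l : EReal) < sigmaPos T) :
    ∃ ε : ℝ, 0 < ε ∧ ∀ z ∈ spec T, ‖z - (l : ℂ)‖ < ε → z = (l : ℂ) := by
  obtain ⟨ε, hε, hu⟩ := exists_isUnit_pencil_near hA l (hT.isClosed_range_pencil hl h)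
  refine ⟨ε, hε, fun z hz hzl => ?_⟩
  by_contra hne
  exact hz (hT.inResolventSet (isUnit_pencil_comp (hu z hne hzl)))

theorem IsInverseOf.isIsolatedEigenvalueIn (hT : IsInverseOf T (P ∘L Q))
    (hA : IsSelfAdjoint (Q ∘L P)) (hP : Function.Injective P) {k : ℕ} (hk : 1 ≤ k)
    (h : eigPos T k < sigmaPos T) : IsIsolatedEigenvalueIn T (eigPos T) (eigPos T k) := by
  have hpos := hT.eigPos_pos hA hP hk
  obtain ⟨l, hl⟩ : ∃ l : ℝ, eigPos T k = l :=
    ⟨_, (EReal.coe_toReal (h.trans_le le_top).ne (bot_le.trans_lt hpos).ne').symm⟩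
  have hl0 : 0 < l := by rw [hl] at hpos; exact_mod_cast hpos
  have hlσ : (l : EReal) < sigmaPos T := hl ▸ h
  have hcard := hT.ncard_eigPos_eq (fun r hr => hT.finite_setOf_eigenspace_ne_bot hA hr)
    (fun r hr => hT.finiteDimensional_eigenSpan hA hP hr) hl0 hlσ
  have hfd := (isFredholmAt_of_lt_sigmaPos hl0 hlσ).finiteDimensional_eigenspace
  refine ⟨l, hl, ⟨?_, hT.exists_inResolventSet_near hA hl0 hlσ⟩, hfd, by rw [hl]; exact hcard⟩
  intro hbot
  obtain ⟨r, hr, hrσ⟩ := EReal.lt_iff_exists_real_btwn.mp hlσ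
  have := hT.finiteDimensional_eigenSpan hA hP hrσ
  -- If `l` had no eigenvectors, the index set would have `ncard` zero although it contains `k`.
  -- Finiteness must be checked because `ncard` of an infinite set is zero as well.
  have hsub : {i : ℕ | 1 ≤ i ∧ eigPos T i = l} ⊆
      Set.Iic (Module.finrank ℂ (eigenSpan T r)) := by
    rintro i ⟨-, hi⟩
    rw [← hi] at hr
    rcases eigPos_lt_iff.mp hr with h1 | ⟨s, -, -, h1, h2⟩
    · exact absurd h1 hrσ.not_gt
    · have h3 := h2.trans (Submodule.rank_mono (eigenSpan_mono T (EReal.coe_le_coe_iff.mp h1.le)))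
      rw [← Module.finrank_eq_rank] at h3
      exact_mod_cast h3
  rw [hbot, finrank_bot, Set.ncard_eq_zero ((Set.finite_Iic _).subset hsub)] at hcard
  exact Set.eq_empty_iff_forall_notMem.mp hcard k ⟨hk, hl⟩

/-- For `r < r' < σ⁺` the eigenvectors up to `r'` span a finite dimension, and the next index
already lies beyond `r`. -/
theorem IsInverseOf.not_forall_eigPos_le (hT : IsInverseOf T (P ∘L Q))
    (hA : IsSelfAdjoint (Q ∘L P)) (hP : Function.Injective P) {r : ℝ}
    (hr : (r : EReal) < sigmaPos T) : ∃ k, (r : EReal) < eigPos T k := by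
  by_contra! h
  obtain ⟨r', hr', hr'σ⟩ := EReal.lt_iff_exists_real_btwn.mp hr
  have := hT.finiteDimensional_eigenSpan hA hP hr'σ
  rcases eigPos_lt_iff.mp ((h (Module.finrank ℂ (eigenSpan T r') + 1)).trans_lt hr') with
    h1 | ⟨s, -, -, h1, h2⟩
  · exact absurd h1 hr'σ.not_gt
  · have h3 := h2.trans (Submodule.rank_mono (eigenSpan_mono T (EReal.coe_le_coe_iff.mp h1.le)))
    rw [← Module.finrank_eq_rank, Nat.cast_le] at h3
    omega

end Model

/-! ### The form domain as a Hilbert space -/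

section Energy

universe u

variable {X : Type u} [NormedAddCommGroup X] [InnerProductSpace ℂ X] {D : Submodule ℂ X}

/-- The form domain of a closed positive definite form `q`, with `q` as inner product. -/
def EnergySpace (q : SesqForm D) (_ : IsClosedPosDefForm q) : Type u := D

variable {q : SesqForm D} (hq : IsClosedPosDefForm q)

instance : AddCommGroup (EnergySpace q hq) := inferInstanceAs (AddCommGroup D)
instance : Module ℂ (EnergySpace q hq) := inferInstanceAs (Module ℂ D)

theorem IsClosedPosDefForm.re_nonneg (hq : IsClosedPosDefForm q) (ψ : D) : 0 ≤ (q ψ ψ).re := by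
  obtain ⟨c, hc, h⟩ := hq.pos
  exact le_trans (by positivity) (h ψ)

/-- The inner product of the energy space. -/
@[reducible]
def energyCore : InnerProductSpace.Core ℂ (EnergySpace q hq) where
  inner ψ φ := q ψ φ
  conj_inner_symm ψ φ := (hq.symm ψ φ).symm
  re_inner_nonneg ψ := hq.re_nonneg ψ
  add_left ψ φ χ := by
    exact LinearMap.map_add₂ q (show D from ψ) φ χ
  smul_left ψ φ z := by
    exact LinearMap.map_smulₛₗ₂ q z (show D from ψ) φ
  definite ψ h := by
    obtain ⟨c, hc, hpos⟩ := hq.pos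
    have h1 := hpos ψ
    have h2 : q ψ ψ = 0 := h
    rw [h2, Complex.zero_re] at h1
    have h3 : ‖(show D from ψ : X)‖ = 0 := by
      by_contra hne
      have : 0 < ‖(show D from ψ : X)‖ := lt_of_le_of_ne (norm_nonneg _) (Ne.symm hne)
      exact absurd h1 (not_le.mpr (by positivity))
    exact Subtype.ext (norm_eq_zero.mp h3)

instance : NormedAddCommGroup (EnergySpace q hq) := (energyCore hq).toNormedAddCommGroup
instance : InnerProductSpace ℂ (EnergySpace q hq) := .ofCore (energyCore hq).toCore

theorem energy_norm_sq (ψ : EnergySpace q hq) : ‖ψ‖ ^ 2 = (q ψ ψ).re :=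
  (inner_self_eq_norm_sq (𝕜 := ℂ) ψ).symm

/-- The inclusion of the energy space into the Hilbert space, as a linear map. -/
def energyInclₗ : EnergySpace q hq →ₗ[ℂ] X := D.subtype

theorem exists_norm_energyInclₗ_le :
    ∃ C : ℝ, ∀ ψ : EnergySpace q hq, ‖energyInclₗ hq ψ‖ ≤ C * ‖ψ‖ := by
  obtain ⟨c, hc, hpos⟩ := hq.pos
  refine ⟨√(c⁻¹), fun ψ => ?_⟩
  refine abs_le_of_sq_le_sq' ?_ (by positivity) |>.2
  rw [mul_pow, Real.sq_sqrt (by positivity), energy_norm_sq, le_inv_mul_iff₀ hc]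
  exact hpos ψ

/-- The inclusion of the energy space into the Hilbert space. -/
def energyIncl : EnergySpace q hq →L[ℂ] X :=
  (energyInclₗ hq).mkContinuousOfExistsBound (exists_norm_energyInclₗ_le hq)

theorem energyIncl_apply (ψ : D) : energyIncl hq ψ = (ψ : X) := rfl

theorem energyIncl_injective : Function.Injective (energyIncl hq) := fun _ _ h => Subtype.ext h

/-- A Cauchy sequence in the energy norm converges in `X` by the lower bound of the form; closedness
of the form turns this into convergence in the energy norm. -/
instance [CompleteSpace X] : CompleteSpace (EnergySpace q hq) := by
  refine Metric.complete_of_cauchySeq_tendsto fun v hv => ?_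
  obtain ⟨x, hx⟩ := cauchySeq_tendsto_of_complete
    ((energyIncl hq).uniformContinuous.comp_cauchySeq hv)
  have h1 := (cauchySeq_iff_tendsto_dist_atTop_0.mp hv).pow 2
  simp only [dist_eq_norm, energy_norm_sq, ne_eq, OfNat.ofNat_ne_zero, not_false_eq_true,
    zero_pow] at h1
  obtain ⟨ψ, -, hψ⟩ := hq.closed v x hx h1
  refine ⟨ψ, tendsto_iff_norm_sub_tendsto_zero.mpr ?_⟩
  have h2 := hψ.sqrt
  rw [Real.sqrt_zero] at h2
  refine h2.congr fun n => ?_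
  have h3 : ∀ φ : EnergySpace q hq, √(q φ φ).re = ‖φ‖ := fun φ => by
    rw [← energy_norm_sq, Real.sqrt_sq (norm_nonneg φ)]
  exact h3 _

end Energy

/-! ### The inverse of `J G` and the criterion in terms of forms -/

section FormOperator

universe u

variable {X : Type u} [NormedAddCommGroup X] [InnerProductSpace ℂ X]
  {D : Submodule ℂ X} {q : SesqForm D} {J : X →L[ℂ] X}

/-- There is a subspace of the form domain of dimension at least `k` on which
`q(ψ, ψ) ≤ r (J ψ, ψ)`. -/
def HasLargeFormSubspace (q : SesqForm D) (J : X →L[ℂ] X) (k : ℕ) (r : ℝ) : Prop :=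
  ∃ S : Submodule ℂ D, (k : Cardinal) ≤ Module.rank ℂ S ∧
    ∀ ψ ∈ S, (q ψ ψ).re ≤ r * (⟪(ψ : X), J ψ⟫_ℂ).re

variable [CompleteSpace X] (hq : IsClosedPosDefForm q)

/-- The operator `ι* J`, where `ι` is the inclusion of the energy space. -/
def energyAdjointMul (J : X →L[ℂ] X) : X →L[ℂ] EnergySpace q hq :=
  ContinuousLinearMap.adjoint (energyIncl hq) ∘L J

/-- The identity `q(φ, ψ) = ⟪φ, η⟫` for all `φ` says `ψ = ι* η`, so the form operator inverts `ι
ι*`; `J² = 1` then moves `J` to the right. -/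
theorem isInverseOf_mulOp (hJ : IsHermitianSymmetry J) :
    IsInverseOf (mulOp J (formOperator q)) (energyIncl hq ∘L energyAdjointMul hq J) := by
  have hJJ : ∀ x, J (J x) = x := fun x => congrArg (fun S : X →L[ℂ] X => S x) hJ.2
  have hgraph : ∀ x y, (x, y) ∈ (formOperator q).graph ↔
      x = energyIncl hq (ContinuousLinearMap.adjoint (energyIncl hq) y) := by
    intro x y
    rw [formOperator_graph q hq.dense]
    constructor
    · rintro ⟨ψ, rfl, h⟩
      rw [← energyIncl_apply hq]
      congr 1
      refine ext_inner_left ℂ fun φ => ?_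
      rw [ContinuousLinearMap.adjoint_inner_right]
      exact h φ
    · rintro rfl
      refine ⟨ContinuousLinearMap.adjoint (energyIncl hq) y, rfl, fun φ => ?_⟩
      exact ContinuousLinearMap.adjoint_inner_right (energyIncl hq) φ y
  intro x y
  have h1 : (x, y) ∈ (mulOp J (formOperator q)).graph ↔ (x, J y) ∈ (formOperator q).graph := by
    simp only [LinearPMap.mem_graph_iff]
    constructor
    · rintro ⟨ψ, h1, h2⟩
      refine ⟨ψ, h1, ?_⟩
      have h3 : J (formOperator q ψ) = y := h2
      rw [← h3, hJJ]
    · rintro ⟨ψ, h1, h2⟩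
      refine ⟨ψ, h1, ?_⟩
      change J (formOperator q ψ) = y
      rw [h2, hJJ]
  rw [h1, hgraph]
  rfl

theorem inner_energyAdjointMul (J : X →L[ℂ] X) (ψ : EnergySpace q hq) (x : X) :
    ⟪ψ, energyAdjointMul hq J x⟫_ℂ = ⟪energyIncl hq ψ, J x⟫_ℂ :=
  ContinuousLinearMap.adjoint_inner_right (energyIncl hq) ψ (J x)

theorem isSelfAdjoint_energyAdjointMul_comp (hJ : IsHermitianSymmetry J) :
    IsSelfAdjoint (energyAdjointMul hq J ∘L energyIncl hq) := by
  rw [ContinuousLinearMap.isSelfAdjoint_iff_isSymmetric]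
  intro ψ φ
  change ⟪energyAdjointMul hq J (energyIncl hq ψ), φ⟫_ℂ =
    ⟪ψ, energyAdjointMul hq J (energyIncl hq φ)⟫_ℂ
  rw [inner_energyAdjointMul, ← inner_conj_symm, inner_energyAdjointMul, inner_conj_symm,
    inner_apply_comm hJ.1]

/-- Removes the inner product that depends on `q`, so that different forms on the same domain become
comparable. -/
theorem hasLargeSubspace_iff (J : X →L[ℂ] X) (k : ℕ) (r : ℝ) :
    HasLargeSubspace (energyAdjointMul hq J ∘L energyIncl hq) k r ↔
      HasLargeFormSubspace q J k r := by
  refine exists_congr fun S => and_congr Iff.rfl (forall₂_congr fun ψ _ => ?_)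
  rw [energy_norm_sq, ContinuousLinearMap.comp_apply, inner_energyAdjointMul]
  rfl

end FormOperator

/-! ### Reflection `T ↦ -T`, exchanging positive and negative spectrum -/

section Negation

variable {X : Type*} [NormedAddCommGroup X] [InnerProductSpace ℂ X]

theorem shift_neg (T : X →ₗ.[ℂ] X) (z : ℂ) : shift (-T) z = -shift T (-z) := by
  refine LinearMap.ext fun ψ => ?_
  change -T ψ - z • (ψ : X) = -(T ψ - (-z) • (ψ : X))
  rw [neg_smul]
  abel

theorem eigenspace_neg (T : X →ₗ.[ℂ] X) (z : ℂ) : eigenspace (-T) z = eigenspace T (-z) := by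
  unfold eigenspace
  rw [shift_neg, LinearMap.ker_neg]
  rfl

theorem isFredholmAt_neg (T : X →ₗ.[ℂ] X) (z : ℂ) :
    IsFredholmAt (-T) z ↔ IsFredholmAt T (-z) := by
  unfold IsFredholmAt
  rw [shift_neg, LinearMap.ker_neg, LinearMap.range_neg]
  rfl

theorem InResolventSet.of_neg {T : X →ₗ.[ℂ] X} {z : ℂ} (h : InResolventSet (-T) z) :
    InResolventSet T (-z) := by
  obtain ⟨R, h1, h2⟩ := h
  rw [shift_neg] at h1 h2
  refine ⟨-R, fun ψ => ?_, fun x => ?_⟩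
  · have := h1 ψ
    rw [LinearMap.neg_apply, map_neg] at this
    exact this
  · obtain ⟨ψ, h3, h4⟩ := h2 (-x)
    refine ⟨ψ, ?_, neg_injective h4⟩
    rw [h3, map_neg]
    rfl

theorem sSup_eq_neg_sInf (S : Set EReal) : sSup S = -sInf (Neg.neg ⁻¹' S) := by
  apply le_antisymm
  · refine sSup_le fun a ha => EReal.le_neg_of_le_neg (sInf_le ?_)
    simpa using ha
  · refine EReal.neg_le_of_neg_le (le_sInf fun a ha => EReal.neg_le_of_neg_le (le_sSup ha))

theorem sigmaNeg_eq (T : X →ₗ.[ℂ] X) : sigmaNeg T = -sigmaPos (-T) := by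
  rw [sigmaNeg, sigmaPos, sSup_eq_neg_sInf]
  congr 2
  ext t
  simp only [Set.mem_preimage, Set.mem_ofPred_eq, essSpec, isFredholmAt_neg]
  constructor
  · rintro ⟨r, h1, h2, h3⟩
    exact ⟨-r, by rw [EReal.coe_neg, ← h1, neg_neg], by linarith, by simpa using h3⟩
  · rintro ⟨r, rfl, h2, h3⟩
    exact ⟨-r, by rw [EReal.coe_neg], by linarith, by simpa using h3⟩

theorem iSup_eigenspace_Ico (T : X →ₗ.[ℂ] X) (r : ℝ) :
    (⨆ s ∈ Set.Ico r (0 : ℝ), eigenspace T (s : ℂ)) = eigenSpan (-T) (-r) := by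
  apply le_antisymm
  · refine iSup₂_le fun s hs => ?_
    have h := eigenspace_le_eigenSpan (-T) (neg_pos.mpr hs.2) (neg_le_neg hs.1)
    rwa [eigenspace_neg, Complex.ofReal_neg, neg_neg] at h
  · refine iSup₂_le fun s hs => ?_
    rw [eigenspace_neg, ← Complex.ofReal_neg]
    exact le_iSup₂_of_le (f := fun s (_ : s ∈ Set.Ico r (0 : ℝ)) => eigenspace T (s : ℂ)) (-s)
      ⟨le_neg_of_le_neg hs.2, neg_neg_iff_pos.mpr hs.1⟩ le_rfl

theorem eigNeg_eq (T : X →ₗ.[ℂ] X) (k : ℕ) : eigNeg T k = -eigPos (-T) k := by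
  rw [eigNeg, eigPos, sSup_eq_neg_sInf]
  congr 2
  ext t
  simp only [Set.mem_preimage, Set.mem_union, Set.mem_singleton_iff, Set.mem_ofPred_eq,
    sigmaNeg_eq, neg_inj]
  refine or_congr Iff.rfl ⟨?_, ?_⟩
  · rintro ⟨r, h1, h2, h3, h4⟩
    refine ⟨-r, by rw [EReal.coe_neg, ← h1, neg_neg], by linarith, ?_,
      by rwa [iSup_eigenspace_Ico] at h4⟩
    rw [EReal.coe_neg]
    exact EReal.neg_lt_of_neg_lt h3
  · rintro ⟨r, rfl, h2, h3, h4⟩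
    refine ⟨-r, by rw [EReal.coe_neg], by linarith, ?_, by
      rwa [iSup_eigenspace_Ico, neg_neg]⟩
    rw [EReal.coe_neg]
    exact EReal.neg_lt_neg_iff.mpr h3

theorem IsIsolatedEigenvalueIn.of_neg {T : X →ₗ.[ℂ] X} {a : EReal}
    (h : IsIsolatedEigenvalueIn (-T) (eigPos (-T)) a) : IsIsolatedEigenvalueIn T (eigNeg T) (-a) := by
  obtain ⟨l, rfl, ⟨h1, ε, hε, h2⟩, h3, h4⟩ := h
  rw [eigenspace_neg, ← Complex.ofReal_neg] at h1 h3 h4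
  refine ⟨-l, (EReal.coe_neg l).symm, ⟨h1, ε, hε, fun z hz hzl => ?_⟩, h3, ?_⟩
  · have h5 := h2 (-z) (fun h => hz (by simpa using h.of_neg)) (by
      rw [← norm_neg]
      simpa [sub_eq_add_neg, add_comm] using hzl)
    rw [Complex.ofReal_neg, ← h5, neg_neg]
  · rw [← h4]
    simp only [eigNeg_eq, neg_inj]

theorem RelClose.neg {κ : ℝ} {a a' : EReal} (h : RelClose κ a a') : RelClose κ (-a) (-a') := by
  rcases h with ⟨h | h, h'⟩ | ⟨l, l', h0, rfl, rfl, h1, h2⟩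
  · exact .inl ⟨.inr (by simp [h]), by rw [h']⟩
  · exact .inl ⟨.inl (by simp [h]), by rw [h']⟩
  · refine .inr ⟨-l, -l', neg_ne_zero.mpr h0, (EReal.coe_neg l).symm, (EReal.coe_neg l').symm, ?_⟩
    have : (-l' - -l) / -l = (l' - l) / l := by
      rw [← neg_div_neg_eq]
      ring
    rw [this]
    exact ⟨h1, h2⟩

theorem mulOp_neg (J : X →L[ℂ] X) (G : X →ₗ.[ℂ] X) : mulOp (-J) G = -mulOp J G := by
  refine LinearPMap.ext rfl fun ψ h1 h2 => ?_
  rfl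

end Negation

/-! ### The perturbed form -/

section Perturbation

variable {X : Type*} [NormedAddCommGroup X] [InnerProductSpace ℂ X] {D : Submodule ℂ X}
  {g δg : SesqForm D} {κ : ℝ}

theorem re_add_form_bounds (hδ : ∀ ψ : D, ‖δg ψ ψ‖ ≤ κ * (g ψ ψ).re) (ψ : D) :
    (1 - κ) * (g ψ ψ).re ≤ ((g + δg) ψ ψ).re ∧ ((g + δg) ψ ψ).re ≤ (1 + κ) * (g ψ ψ).re := by
  have h1 := abs_le.mp ((Complex.abs_re_le_norm _).trans (hδ ψ))
  simp only [LinearMap.add_apply, Complex.add_re]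
  constructor <;> linarith [h1.1, h1.2]

/-- Both forms bound each other up to positive constants, so positivity, Cauchy sequences and limits
are shared. -/
theorem IsClosedPosDefForm.add (hg : IsClosedPosDefForm g) (hsymm : IsSymmForm δg) (hκ1 : κ < 1)
    (hδ : ∀ ψ : D, ‖δg ψ ψ‖ ≤ κ * (g ψ ψ).re) : IsClosedPosDefForm (g + δg) where
  dense := hg.dense
  symm ψ φ := by
    simp only [LinearMap.add_apply, map_add]
    rw [hg.symm ψ φ, hsymm ψ φ]
  pos := by
    obtain ⟨c, hc, h⟩ := hg.pos
    refine ⟨(1 - κ) * c, mul_pos (by linarith) hc, fun ψ => ?_⟩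
    refine le_trans ?_ (re_add_form_bounds hδ ψ).1
    rw [mul_assoc]
    exact mul_le_mul_of_nonneg_left (h ψ) (by linarith)
  closed u x hx hu := by
    have hκ : 0 < 1 - κ := by linarith
    obtain ⟨ψ, h1, h2⟩ := hg.closed u x hx (by
      refine squeeze_zero (fun _ => hg.re_nonneg _) (fun p => ?_)
        (by simpa only [mul_zero] using hu.const_mul (1 - κ)⁻¹)
      rw [le_inv_mul_iff₀ hκ]
      exact (re_add_form_bounds hδ _).1)
    refine ⟨ψ, h1, squeeze_zero (fun n => ?_) (fun n => (re_add_form_bounds hδ _).2)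
      (by simpa only [mul_zero] using h2.const_mul (1 + κ))⟩
    exact (mul_nonneg hκ.le (hg.re_nonneg _)).trans (re_add_form_bounds hδ _).1

end Perturbation

/-! ### Comparison of the two eigenvalue sequences -/

section Comparison

/-- The criterion controls only numbers strictly above an eigenvalue; letting `r` decrease to it
gives the closed inequalities. Finiteness of one side forces finiteness of the other. -/
theorem relClose_of_forall_lt {u u' : EReal} (hu : 0 < u) (hu' : 0 < u') {κ : ℝ} (hκ0 : 0 ≤ κ)
    (hκ1 : κ < 1) (h : ∀ r : ℝ, u < r → u' ≤ ((1 + κ) * r : ℝ))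
    (h' : ∀ r : ℝ, u' < r → u ≤ (r / (1 - κ) : ℝ)) : RelClose κ u u' := by
  have hbot : u ≠ ⊥ := (bot_le.trans_lt hu).ne'
  have hbot' : u' ≠ ⊥ := (bot_le.trans_lt hu').ne'
  by_cases htop : u = ⊤
  · refine .inl ⟨.inl htop, ?_⟩
    rw [htop]
    by_contra hne
    obtain ⟨r, hr, -⟩ := EReal.lt_iff_exists_real_btwn.mp (Ne.lt_top hne)
    exact (EReal.coe_lt_top _).not_ge (htop ▸ h' r hr)
  lift u to ℝ using ⟨htop, hbot⟩
  have htop' : u' ≠ ⊤ := by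
    refine ((h (u + 1) ?_).trans_lt (EReal.coe_lt_top _)).ne
    exact_mod_cast lt_add_one u
  lift u' to ℝ using ⟨htop', hbot'⟩
  have hu0 : 0 < u := by exact_mod_cast hu
  have hκ : 0 < 1 - κ := by linarith
  refine .inr ⟨u, u', hu0.ne', rfl, rfl, ?_, ?_⟩
  · rw [le_div_iff₀ hu0]
    have : u * (1 - κ) ≤ u' := by
      refine le_of_forall_gt_imp_ge_of_dense fun r hr => ?_
      rw [← le_div_iff₀ hκ]
      exact_mod_cast h' r (by exact_mod_cast hr)
    linarith
  · rw [div_le_iff₀ hu0]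
    have : u' / (1 + κ) ≤ u := by
      refine le_of_forall_gt_imp_ge_of_dense fun r hr => ?_
      rw [div_le_iff₀' (by linarith)]
      exact_mod_cast h r (by exact_mod_cast hr)
    rw [div_le_iff₀ (by linarith)] at this
    linarith

variable {X : Type*} [NormedAddCommGroup X] [InnerProductSpace ℂ X]
  {D : Submodule ℂ X} {g δg : SesqForm D} {κ : ℝ} {J : X →L[ℂ] X}

/-- The same trial subspace serves: `(ψ, J ψ)` does not change with the form. -/
theorem HasLargeFormSubspace.add {k : ℕ} {r : ℝ} (hκ0 : 0 ≤ κ)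
    (hδ : ∀ ψ : D, ‖δg ψ ψ‖ ≤ κ * (g ψ ψ).re) (h : HasLargeFormSubspace g J k r) :
    HasLargeFormSubspace (g + δg) J k ((1 + κ) * r) := by
  obtain ⟨S, hk, hS⟩ := h
  refine ⟨S, hk, fun ψ hψ => (re_add_form_bounds hδ ψ).2.trans ?_⟩
  rw [mul_assoc]
  exact mul_le_mul_of_nonneg_left (hS ψ hψ) (by linarith)

theorem HasLargeFormSubspace.of_add {k : ℕ} {r : ℝ} (hκ1 : κ < 1)
    (hδ : ∀ ψ : D, ‖δg ψ ψ‖ ≤ κ * (g ψ ψ).re) (h : HasLargeFormSubspace (g + δg) J k r) :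
    HasLargeFormSubspace g J k (r / (1 - κ)) := by
  obtain ⟨S, hk, hS⟩ := h
  have hκ : 0 < 1 - κ := by linarith
  refine ⟨S, hk, fun ψ hψ => ?_⟩
  rw [div_mul_eq_mul_div, le_div_iff₀' hκ]
  exact (re_add_form_bounds hδ ψ).1.trans (hS ψ hψ)

variable [CompleteSpace X]

theorem hasLargeFormSubspace_of_eigPos_lt (hg : IsClosedPosDefForm g) (hJ : IsHermitianSymmetry J)
    {k : ℕ} {r : ℝ} (h : eigPos (mulOp J (formOperator g)) k < r) : HasLargeFormSubspace g J k r :=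
  (hasLargeSubspace_iff hg J k r).mp ((isInverseOf_mulOp hg hJ).hasLargeSubspace_of_eigPos_lt
    (isSelfAdjoint_energyAdjointMul_comp hg hJ) (energyIncl_injective hg) h)

theorem eigPos_le_of_hasLargeFormSubspace (hg : IsClosedPosDefForm g) (hJ : IsHermitianSymmetry J)
    {k : ℕ} {r : ℝ} (hr : 0 < r) (h : HasLargeFormSubspace g J k r) :
    eigPos (mulOp J (formOperator g)) k ≤ r :=
  (isInverseOf_mulOp hg hJ).eigPos_le_of_hasLargeSubspace
    (isSelfAdjoint_energyAdjointMul_comp hg hJ) (energyIncl_injective hg) hr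
    ((hasLargeSubspace_iff hg J k r).mpr h)

theorem eigPos_mulOp_pos (hg : IsClosedPosDefForm g) (hJ : IsHermitianSymmetry J)
    {k : ℕ} (hk : 1 ≤ k) : 0 < eigPos (mulOp J (formOperator g)) k :=
  (isInverseOf_mulOp hg hJ).eigPos_pos
    (isSelfAdjoint_energyAdjointMul_comp hg hJ) (energyIncl_injective hg) hk

theorem relClose_eigPos (hg : IsClosedPosDefForm g) (hJ : IsHermitianSymmetry J)
    (hsymm : IsSymmForm δg) (hκ0 : 0 ≤ κ) (hκ1 : κ < 1)
    (hδ : ∀ ψ : D, ‖δg ψ ψ‖ ≤ κ * (g ψ ψ).re) {k : ℕ} (hk : 1 ≤ k) :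
    RelClose κ (eigPos (mulOp J (formOperator g)) k)
      (eigPos (mulOp J (formOperator (g + δg))) k) := by
  have hg' := hg.add hsymm hκ1 hδ
  have hκ : 0 < 1 - κ := by linarith
  refine relClose_of_forall_lt (eigPos_mulOp_pos hg hJ hk) (eigPos_mulOp_pos hg' hJ hk) hκ0 hκ1
    (fun r hr => ?_) fun r hr => ?_
  · have hr0 : 0 < r := by exact_mod_cast (eigPos_mulOp_pos hg hJ hk).trans hr
    exact eigPos_le_of_hasLargeFormSubspace hg' hJ (by positivity)
      ((hasLargeFormSubspace_of_eigPos_lt hg hJ hr).add hκ0 hδ)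
  · have hr0 : 0 < r := by exact_mod_cast (eigPos_mulOp_pos hg' hJ hk).trans hr
    exact eigPos_le_of_hasLargeFormSubspace hg hJ (by positivity)
      ((hasLargeFormSubspace_of_eigPos_lt hg' hJ hr).of_add hκ1 hδ)

theorem isIsolatedEigenvalueIn_eigPos (hg : IsClosedPosDefForm g) (hJ : IsHermitianSymmetry J)
    (hsymm : IsSymmForm δg) (hκ0 : 0 ≤ κ) (hκ1 : κ < 1)
    (hδ : ∀ ψ : D, ‖δg ψ ψ‖ ≤ κ * (g ψ ψ).re) {n : ℕ}
    (hn : ((1 + κ : ℝ) : EReal) * eigPos (mulOp J (formOperator g)) n <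
      ((1 - κ : ℝ) : EReal) * sigmaPos (mulOp J (formOperator g)))
    {k : ℕ} (hk : 1 ≤ k) (hkn : k ≤ n) :
    IsIsolatedEigenvalueIn (mulOp J (formOperator (g + δg)))
      (eigPos (mulOp J (formOperator (g + δg)))) (eigPos (mulOp J (formOperator (g + δg))) k) := by
  have hg' := hg.add hsymm hκ1 hδ
  have hκ : 0 < 1 - κ := by linarith
  have hclose := fun {j : ℕ} => relClose_eigPos (k := j) hg hJ hsymm hκ0 hκ1 hδ
  have hpos := fun {j : ℕ} => eigPos_mulOp_pos (k := j) hg hJ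
  have hmono := eigPos_mono (mulOp J (formOperator (g + δg))) hkn
  have hacc : ∀ r : ℝ, (r : EReal) < sigmaPos (mulOp J (formOperator g)) →
      ∃ j, (r : EReal) < eigPos (mulOp J (formOperator g)) j := fun r hr =>
    (isInverseOf_mulOp hg hJ).not_forall_eigPos_le
      (isSelfAdjoint_energyAdjointMul_comp hg hJ) (energyIncl_injective hg) hr
  refine (isInverseOf_mulOp hg' hJ).isIsolatedEigenvalueIn
    (isSelfAdjoint_energyAdjointMul_comp hg' hJ) (energyIncl_injective hg') hk ?_
  -- If `λ'_k = σ'⁺`, then every `λ'_j` is at most `λ'_n ≤ (1 + κ) λ_n`. Hence `(1 - κ) λ_j ≤ (1 +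
  -- κ) λ_n` for all `j ≥ 1`, against `hacc` at the point `(1 + κ) λ_n / (1 - κ) < σ⁺`.
  refine lt_of_le_of_ne (eigPos_le_sigmaPos _ _) fun heq => ?_
  have hlt : ∀ j, eigPos (mulOp J (formOperator (g + δg))) j ≤
      eigPos (mulOp J (formOperator (g + δg))) n := fun j =>
    (eigPos_le_sigmaPos _ j).trans (heq ▸ hmono)
  rcases hclose (hk.trans hkn) with ⟨h | h, -⟩ | ⟨l, l', hl0, hl, hl', -, h2⟩
  · rw [h, EReal.coe_mul_top_of_pos (by linarith)] at hn
    exact not_top_lt hn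
  · exact (bot_le.trans_lt (hpos (hk.trans hkn))).ne' h
  have hlpos : 0 < l := by
    have := hpos (hk.trans hkn)
    rw [hl] at this
    exact_mod_cast this
  rw [div_le_iff₀ hlpos] at h2
  have hσ : (((1 + κ) * l / (1 - κ) : ℝ) : EReal) < sigmaPos (mulOp J (formOperator g)) := by
    rw [hl, ← EReal.coe_mul] at hn
    rw [EReal.coe_div]
    exact (EReal.div_lt_iff (by exact_mod_cast hκ) (EReal.coe_ne_top _)).mpr
      (by rwa [mul_comm _ ((1 - κ : ℝ) : EReal)])
  obtain ⟨j, hj⟩ := hacc _ hσ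
  -- The index `j` may be 0, where the relative bound is not available; monotonicity allows passing
  -- to a later index.
  obtain ⟨i, hi1, hij⟩ : ∃ i, 1 ≤ i ∧ j ≤ i := ⟨j + 1, by omega, by omega⟩
  replace hj := hj.trans_le (eigPos_mono _ hij)
  have hlti := hlt i
  rcases hclose hi1 with ⟨h | h, h'⟩ | ⟨m, m', hm0, hm, hm', h3, -⟩
  · rw [h', h, hl'] at hlti
    exact (EReal.coe_lt_top _).not_ge hlti
  · exact (bot_le.trans_lt (hpos hi1)).ne' h
  · have hmpos : 0 < m := by
      have := hpos hi1
      rw [hm] at this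
      exact_mod_cast this
    rw [le_div_iff₀ hmpos] at h3
    rw [hm', hl', EReal.coe_le_coe_iff] at hlti
    rw [hm, EReal.coe_lt_coe_iff, div_lt_iff₀ hκ] at hj
    nlinarith

end Comparison

end KreinPerturbation

end

theorem mainTheorem2 {X : Type*} [NormedAddCommGroup X] [InnerProductSpace ℂ X] [CompleteSpace X]
    (J : X →L[ℂ] X) (hJ : KreinPerturbation.IsHermitianSymmetry J)
    (G : X →ₗ.[ℂ] X) (hG : KreinPerturbation.IsPosDefOperator G)
    (D : Submodule ℂ X) (g : KreinPerturbation.SesqForm D) (hg : KreinPerturbation.IsFormOf g G)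
    (H : X →ₗ.[ℂ] X) (hH : H = KreinPerturbation.mulOp J G)
    (hspec : KreinPerturbation.IsJSpectral J H)
    (δg : KreinPerturbation.SesqForm D) (hsymm : KreinPerturbation.IsSymmForm δg)
    (κ : ℝ) (hκ0 : 0 ≤ κ) (hκ1 : κ < 1)
    (hδ : ∀ ψ : D, ‖δg ψ ψ‖ ≤ κ * (g ψ ψ).re)
    (G' : X →ₗ.[ℂ] X) (hG' : G' = KreinPerturbation.formOperator (g + δg))
    (H' : X →ₗ.[ℂ] X) (hH' : H' = KreinPerturbation.mulOp J G') :
    (∀ k : ℕ, 1 ≤ k →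
      KreinPerturbation.RelClose κ (KreinPerturbation.eigPos H k) (KreinPerturbation.eigPos H' k) ∧
      KreinPerturbation.RelClose κ (KreinPerturbation.eigNeg H k) (KreinPerturbation.eigNeg H' k)) ∧
    (∀ n : ℕ, 1 ≤ n →
      ((1 + κ : ℝ) : EReal) * KreinPerturbation.eigPos H n <
        ((1 - κ : ℝ) : EReal) * KreinPerturbation.sigmaPos H →
      ∀ k : ℕ, 1 ≤ k → k ≤ n →
        KreinPerturbation.IsIsolatedEigenvalueIn H' (KreinPerturbation.eigPos H')
          (KreinPerturbation.eigPos H' k)) ∧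
    (∀ n : ℕ, 1 ≤ n →
      ((1 - κ : ℝ) : EReal) * KreinPerturbation.sigmaNeg H <
        ((1 + κ : ℝ) : EReal) * KreinPerturbation.eigNeg H n →
      ∀ k : ℕ, 1 ≤ k → k ≤ n →
        KreinPerturbation.IsIsolatedEigenvalueIn H' (KreinPerturbation.eigNeg H')
          (KreinPerturbation.eigNeg H' k)) := by
  open KreinPerturbation in
  obtain ⟨hgc, rfl⟩ := hg
  subst hG' hH hH'
  -- Since `(-J) G = -(J G)`, the negative half is the positive half for the symmetry `-J` with the
  -- same forms.
  have hJn : IsHermitianSymmetry (-J) := ⟨hJ.1.neg, by rw [neg_mul_neg]; exact hJ.2⟩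
  refine ⟨fun k hk => ⟨relClose_eigPos hgc hJ hsymm hκ0 hκ1 hδ hk, ?_⟩,
    fun n _ hn k hk hkn => isIsolatedEigenvalueIn_eigPos hgc hJ hsymm hκ0 hκ1 hδ hn hk hkn,
    fun n _ hn k hk hkn => ?_⟩
  · rw [eigNeg_eq, eigNeg_eq, ← mulOp_neg, ← mulOp_neg]
    exact (relClose_eigPos hgc hJn hsymm hκ0 hκ1 hδ hk).neg
  · rw [sigmaNeg_eq, eigNeg_eq, mul_neg, mul_neg, EReal.neg_lt_neg_iff, ← mulOp_neg] at hn
    rw [eigNeg_eq]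
    refine IsIsolatedEigenvalueIn.of_neg ?_
    rw [← mulOp_neg]
    exact isIsolatedEigenvalueIn_eigPos hgc hJn hsymm hκ0 hκ1 hδ hn hk hkn
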